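/- Let $\mathcal H_3=\mathbb C\times\mathbb R$ be the Heisenberg group, with points $(z,\tau)$, $z=y_1+iy_2$, and with Lebesgue measure as Haar measure. Let $$X=\frac{\partial}{\partial y_1}-2y_2\frac{\partial}{\partial\tau},\qquad Y=\frac{\partial}{\partial y_2}+2y_1\frac{\partial}{\partial\tau},\qquad \mathcal L=-(X^2+Y^2),$$ and let $\mathcal L_0$ be the closure in $L^2(\mathcal H_3)$ (complex-valued functions) of the sub-Laplacian $\mathcal L$ with domain the Schwartz space $\mathcal S(\mathcal H_3)$; $\mathcal L$ is symmetric and densely defined, hence closable. For a closed densely defined linear operator $\mathcal T$ in a complex Banach space $E$, call $\mathcal T-\lambda I:\mathcal D(\mathcal T)\to E$ Fredholm if its kernel is finite-dimensional, its range is closed and its cokernel $E/\mathrm{Range}(\mathcal T-\lambda I)$ is finite-dimensional; its index is then the dimension of the kernel minus the dimension of the cokernel. Define the essential spectra - (Dunford–Schwartz) $\Sigma_{DS}(\mathcal T)=\{\lambda\in\mathbb C : \mathrm{Range}(\mathcal T-\lambda I)\text{ is not closed in }E\}$, - (Wolf) $\Sigma_W(\mathcal T)=\{\lambda\in\mathbb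 C : \mathcal T-\lambda I\text{ is not Fredholm}\}$, - (Schechter) $\Sigma_S(\mathcal T)=\{\lambda\in\mathbb C : \mathcal T-\lambda I\text{ is not a Fredholm operator of index }0\}$. Then $$\Sigma_{DS}(\mathcal L_0)=\Sigma_W(\mathcal L_0)=\Sigma_S(\mathcal L_0)=[0,\infty).$$ -/

import Mathlib

open MeasureTheory SchwartzMap
open scoped LineDeriv

noncomputable section

namespace LinearPMap

variable {E : Type*} [NormedAddCommGroup E] [NormedSpace ℂ E]

/-- The operator `T - lam • I`, with the same domain as `T`. -/
def subScalar (T : E →ₗ.[ℂ] E) (lam : ℂ) : T.domain →ₗ[ℂ] E :=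
  T.toFun - lam • T.domain.subtype

/-- The Dunford–Schwartz essential spectrum: those `lam` for which the range of `T - lam • I` is
not closed. -/
def essSpectrumDS (T : E →ₗ.[ℂ] E) : Set ℂ :=
  {lam | ¬ _root_.IsClosed (LinearMap.range (T.subScalar lam) : Set E)}

/-- `T - lam • I` is Fredholm: finite-dimensional kernel, closed range, finite-dimensional
cokernel. -/
structure IsFredholmAt (T : E →ₗ.[ℂ] E) (lam : ℂ) : Prop where
  finite_ker : FiniteDimensional ℂ (LinearMap.ker (T.subScalar lam))
  closed_range : _root_.IsClosed (LinearMap.range (T.subScalar lam) : Set E)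
  finite_coker : FiniteDimensional ℂ (E ⧸ LinearMap.range (T.subScalar lam))

/-- The index of `T - lam • I`: the dimension of the kernel minus the dimension of the cokernel
(only meaningful if both are finite, as they are where `T - lam • I` is Fredholm). -/
def fredholmIndexAt (T : E →ₗ.[ℂ] E) (lam : ℂ) : ℤ :=
  (Module.finrank ℂ (LinearMap.ker (T.subScalar lam)) : ℤ) -
    (Module.finrank ℂ (E ⧸ LinearMap.range (T.subScalar lam)) : ℤ)

/-- The Wolf essential spectrum: those `lam` for which `T - lam • I` is not Fredholm. -/
def essSpectrumWolf (T : E →ₗ.[ℂ] E) : Set ℂ :=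
  {lam | T.IsFredholmAt lam}ᶜ

/-- The Schechter essential spectrum: those `lam` for which `T - lam • I` is not a Fredholm
operator of index `0`. -/
def essSpectrumSchechter (T : E →ₗ.[ℂ] E) : Set ℂ :=
  {lam | T.IsFredholmAt lam ∧ T.fredholmIndexAt lam = 0}ᶜ

end LinearPMap

namespace Heisenberg

/-- The underlying space `ℂ × ℝ` of the Heisenberg group; its points are written `(z, τ)` with
`z = y₁ + i y₂`, and its Haar measure is the Lebesgue measure `volume`. -/
abbrev H3 : Type := ℂ × ℝ

instance instIsAddHaarMeasureVolume : (volume : Measure H3).IsAddHaarMeasure :=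
  inferInstanceAs ((volume : Measure ℂ).prod (volume : Measure ℝ)).IsAddHaarMeasure

/-- The Hilbert space of complex square-integrable functions on the Heisenberg group. -/
abbrev L2 : Type := Lp ℂ 2 (volume : Measure H3)

/-- The vector field `X = ∂/∂y₁ - 2 y₂ ∂/∂τ` acting on Schwartz functions. -/
def fieldX : 𝓢(H3, ℂ) →L[ℂ] 𝓢(H3, ℂ) :=
  LineDeriv.lineDerivOpCLM ℂ 𝓢(H3, ℂ) ((1, 0) : H3) -
    (smulLeftCLM ℂ fun p : H3 => ((2 * p.1.im : ℝ) : ℂ)) ∘L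
      LineDeriv.lineDerivOpCLM ℂ 𝓢(H3, ℂ) ((0, 1) : H3)

/-- The vector field `Y = ∂/∂y₂ + 2 y₁ ∂/∂τ` acting on Schwartz functions. -/
def fieldY : 𝓢(H3, ℂ) →L[ℂ] 𝓢(H3, ℂ) :=
  LineDeriv.lineDerivOpCLM ℂ 𝓢(H3, ℂ) ((Complex.I, 0) : H3) +
    (smulLeftCLM ℂ fun p : H3 => ((2 * p.1.re : ℝ) : ℂ)) ∘L
      LineDeriv.lineDerivOpCLM ℂ 𝓢(H3, ℂ) ((0, 1) : H3)

/-- The sub-Laplacian `-(X² + Y²)` on Schwartz functions. -/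
def subLaplacianSchwartz : 𝓢(H3, ℂ) →L[ℂ] 𝓢(H3, ℂ) :=
  -(fieldX ∘L fieldX + fieldY ∘L fieldY)

theorem hasTemperateGrowth_im :
    (fun p : H3 => ((2 * p.1.im : ℝ) : ℂ)).HasTemperateGrowth := by
  exact (Complex.ofRealCLM.comp ((2 : ℝ) • (Complex.imCLM.comp
    (ContinuousLinearMap.fst ℝ ℂ ℝ)))).hasTemperateGrowth

theorem hasTemperateGrowth_re :
    (fun p : H3 => ((2 * p.1.re : ℝ) : ℂ)).HasTemperateGrowth := by
  exact (Complex.ofRealCLM.comp ((2 : ℝ) • (Complex.reCLM.comp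
    (ContinuousLinearMap.fst ℝ ℂ ℝ)))).hasTemperateGrowth

/-- `X` is the derivative in the direction `(1, -2 y₂)`. -/
theorem fieldX_apply (f : 𝓢(H3, ℂ)) (p : H3) :
    fieldX f p = fderiv ℝ f p (1, -(2 * p.1.im)) := by
  have h : ((1, -(2 * p.1.im)) : H3) = (1, 0) - (2 * p.1.im) • ((0, 1) : H3) := by
    ext <;> simp
  rw [h, map_sub, map_smul]
  have h2 := smulLeftCLM_apply_apply hasTemperateGrowth_im (∂_{((0, 1) : H3)} f) p
  rw [lineDerivOp_apply_eq_fderiv] at h2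
  change (∂_{((1, 0) : H3)} f) p - smulLeftCLM ℂ _ (∂_{((0, 1) : H3)} f) p = _
  rw [h2, lineDerivOp_apply_eq_fderiv]
  simp

/-- `Y` is the derivative in the direction `(i, 2 y₁)`. -/
theorem fieldY_apply (f : 𝓢(H3, ℂ)) (p : H3) :
    fieldY f p = fderiv ℝ f p (Complex.I, 2 * p.1.re) := by
  have h : ((Complex.I, 2 * p.1.re) : H3) = (Complex.I, 0) + (2 * p.1.re) • ((0, 1) : H3) := by
    ext <;> simp
  rw [h, map_add, map_smul]
  have h2 := smulLeftCLM_apply_apply hasTemperateGrowth_re (∂_{((0, 1) : H3)} f) p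
  rw [lineDerivOp_apply_eq_fderiv] at h2
  change (∂_{((Complex.I, 0) : H3)} f) p + smulLeftCLM ℂ _ (∂_{((0, 1) : H3)} f) p = _
  rw [h2, lineDerivOp_apply_eq_fderiv]
  simp

/-- The inclusion of the Schwartz space into `L²`. -/
def schwartzIncl : 𝓢(H3, ℂ) →ₗ[ℂ] L2 :=
  (toLpCLM ℂ ℂ 2 (volume : Measure H3)).toLinearMap

theorem schwartzIncl_injective : Function.Injective schwartzIncl :=
  injective_toLp 2 (volume : Measure H3)

/-- The sub-Laplacian as an unbounded operator in `L²` with domain the Schwartz space. -/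
def subLaplacian : L2 →ₗ.[ℂ] L2 where
  domain := LinearMap.range schwartzIncl
  toFun := (schwartzIncl ∘ₗ subLaplacianSchwartz.toLinearMap) ∘ₗ
    (LinearEquiv.ofInjective schwartzIncl schwartzIncl_injective).symm.toLinearMap

theorem dense_domain_subLaplacian : Dense (subLaplacian.domain : Set L2) :=
  denseRange_toLpCLM (E := H3) (F := ℂ) (p := 2) (μ := volume) (by simp)

theorem subLaplacian_apply (f : 𝓢(H3, ℂ)) (hf : schwartzIncl f ∈ subLaplacian.domain) :
    subLaplacian ⟨schwartzIncl f, hf⟩ = schwartzIncl (subLaplacianSchwartz f) := by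
  have h : (LinearEquiv.ofInjective schwartzIncl schwartzIncl_injective).symm
      ⟨schwartzIncl f, hf⟩ = f := by
    rw [LinearEquiv.symm_apply_eq]; rfl
  change schwartzIncl (subLaplacianSchwartz _) = _
  exact congrArg (fun g => schwartzIncl (subLaplacianSchwartz g)) h

theorem inner_schwartzIncl (f g : 𝓢(H3, ℂ)) :
    inner ℂ (schwartzIncl f) (schwartzIncl g) = ∫ p, inner ℂ (f p) (g p) :=
  inner_toL2_toL2_eq f g (volume : Measure H3)

theorem inner_lineDeriv (v : H3) (f g : 𝓢(H3, ℂ)) :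
    inner ℂ (schwartzIncl (∂_{v} f)) (schwartzIncl g) =
      -inner ℂ (schwartzIncl f) (schwartzIncl (∂_{v} g)) := by
  have key := integral_bilinear_lineDerivOp_right_eq_neg_left (μ := (volume : Measure H3)) f g
    ((ContinuousLinearMap.mul ℝ ℂ).comp Complex.conjCLE.toContinuousLinearMap) v
  rw [inner_schwartzIncl, inner_schwartzIncl]
  simp only [ContinuousLinearMap.comp_apply, ContinuousLinearMap.mul_apply'] at key
  simp only [RCLike.inner_apply']
  exact (neg_eq_iff_eq_neg.mpr key).symm

theorem inner_smulLeft {a : H3 → ℝ} (ha : (fun p => (a p : ℂ)).HasTemperateGrowth)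
    (f g : 𝓢(H3, ℂ)) :
    inner ℂ (schwartzIncl (smulLeftCLM ℂ (fun p => (a p : ℂ)) f)) (schwartzIncl g) =
      inner ℂ (schwartzIncl f) (schwartzIncl (smulLeftCLM ℂ (fun p => (a p : ℂ)) g)) := by
  rw [inner_schwartzIncl, inner_schwartzIncl]
  congr 1
  ext p
  simp only [smulLeftCLM_apply_apply ha, RCLike.inner_apply, smul_eq_mul, map_mul,
    Complex.conj_ofReal]
  ring

theorem lineDeriv_smulLeft {b : ℂ → ℝ} (hb : (fun p : H3 => (b p.1 : ℂ)).HasTemperateGrowth)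
    (f : 𝓢(H3, ℂ)) :
    ∂_{((0, 1) : H3)} (smulLeftCLM ℂ (fun p : H3 => (b p.1 : ℂ)) f) =
      smulLeftCLM ℂ (fun p : H3 => (b p.1 : ℂ)) (∂_{((0, 1) : H3)} f) := by
  ext p
  rw [smulLeftCLM_apply_apply hb, lineDerivOp_apply, lineDerivOp_apply, lineDeriv, lineDeriv]
  simp [smulLeftCLM_apply_apply hb, deriv_const_mul_field']

theorem inner_fieldX (f g : 𝓢(H3, ℂ)) :
    inner ℂ (schwartzIncl (fieldX f)) (schwartzIncl g) =
      -inner ℂ (schwartzIncl f) (schwartzIncl (fieldX g)) := by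
  simp only [fieldX, sub_apply, ContinuousLinearMap.comp_apply,
    LineDeriv.lineDerivOpCLM_apply, map_sub, inner_sub_left, inner_sub_right]
  rw [inner_lineDeriv, inner_smulLeft hasTemperateGrowth_im, inner_lineDeriv,
    lineDeriv_smulLeft (b := fun z => 2 * z.im) hasTemperateGrowth_im]
  ring

theorem inner_fieldY (f g : 𝓢(H3, ℂ)) :
    inner ℂ (schwartzIncl (fieldY f)) (schwartzIncl g) =
      -inner ℂ (schwartzIncl f) (schwartzIncl (fieldY g)) := by
  simp only [fieldY, add_apply, ContinuousLinearMap.comp_apply,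
    LineDeriv.lineDerivOpCLM_apply, map_add, inner_add_left, inner_add_right]
  rw [inner_lineDeriv, inner_smulLeft hasTemperateGrowth_re, inner_lineDeriv,
    lineDeriv_smulLeft (b := fun z => 2 * z.re) hasTemperateGrowth_re]
  ring

theorem isFormalAdjoint_subLaplacian : subLaplacian.IsFormalAdjoint subLaplacian := by
  rintro ⟨_, f, rfl⟩ ⟨_, g, rfl⟩
  change inner ℂ (subLaplacian ⟨schwartzIncl f, f, rfl⟩) (schwartzIncl g) =
    inner ℂ (schwartzIncl f) (subLaplacian ⟨schwartzIncl g, g, rfl⟩)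
  rw [subLaplacian_apply f ⟨f, rfl⟩, subLaplacian_apply g ⟨g, rfl⟩]
  simp only [subLaplacianSchwartz, neg_apply, add_apply,
    ContinuousLinearMap.comp_apply, map_neg, map_add, inner_neg_left, inner_neg_right,
    inner_add_left, inner_add_right, inner_fieldX, inner_fieldY, neg_neg]

/-- The sub-Laplacian is closable, so that its closure is meaningful. -/
theorem isClosable_subLaplacian : subLaplacian.IsClosable :=
  (LinearPMap.adjoint_isClosed dense_domain_subLaplacian).isClosable.leIsClosable
    (isFormalAdjoint_subLaplacian.le_adjoint dense_domain_subLaplacian)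

/-- The closure `𝓛₀` of the sub-Laplacian in `L²`. -/
def subLaplacianClosure : L2 →ₗ.[ℂ] L2 :=
  subLaplacian.closure

end Heisenberg

end

open scoped ContDiff

/-! ### Closed operators: graphs, lower bounds and closed ranges. -/

namespace LinearPMap

section Banach

variable {E : Type*} [NormedAddCommGroup E] [NormedSpace ℂ E]

/-! The three essential spectra coincide because only two cases occur: on the half-line the range of
`L - lam` is not closed, and off it `L - lam` is bijective (`essSpectra_eq_of_dichotomy`).

Everything is computed on the Fourier side, with frequency `(ξ, μ)`, where `X ± iY` act as ladder
operators on `freqMap a b ψ`, that is, on `ξ^a conj(ξ)^b exp(-π|ξ|²/(2|μ|)) ψ(μ)` with `ψ` a test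
function off `μ = 0`. On these functions the sub-Laplacian is triangular: it multiplies `ψ` by
`level a b μ ≥ 0` and subtracts a multiple of a function with indices `(a-1, b-1)`
(`subLaplacianSchwartz_invFourier_freqMap`). Their span is dense
(`eq_zero_of_inner_freqMap_eq_zero`).

Off the half-line, positivity of `L` bounds `L - lam` from below, so its kernel is zero and its
range is closed. Dividing by `level a b μ - lam` and inducting on `a` shows that nothing nonzero is
orthogonal to the range, which is therefore everything.

For `r ≥ 0`, take `ψ` supported where `r < 8π|μ| < r + ε`. Then `f`, the inverse transform of
`freqMap 0 0 ψ`, satisfies `‖(L - r)f‖ ≤ ε‖f‖`. Moreover `f` lies in the range of `L - r`, so by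
symmetry it is orthogonal to the kernel, and no preimage of `(L - r)f` is shorter than `f`. A closed
range would give, by the open mapping theorem, a preimage of norm at most `Cε‖f‖`: a contradiction
for small `ε`. No knowledge of the kernel is needed. -/

theorem mem_range_subScalar_iff (T : E →ₗ.[ℂ] E) (lam : ℂ) (y : E) :
    y ∈ LinearMap.range (T.subScalar lam) ↔ ∃ p ∈ T.graph, p.2 - lam • p.1 = y := by
  constructor
  · rintro ⟨u, rfl⟩
    exact ⟨(u, T u), T.mem_graph u, rfl⟩
  · rintro ⟨p, hp, rfl⟩
    obtain ⟨u, hu, hv⟩ := (T.mem_graph_iff).1 hp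
    refine ⟨u, ?_⟩
    rw [← hu, ← hv]
    rfl

/-- The map `(u, T u) ↦ T u - lam • u` on the graph of `T`. -/
noncomputable def graphSubScalar (T : E →ₗ.[ℂ] E) (lam : ℂ) : T.graph →L[ℂ] E :=
  (ContinuousLinearMap.snd ℂ E E - lam • ContinuousLinearMap.fst ℂ E E).comp T.graph.subtypeL

theorem range_graphSubScalar (T : E →ₗ.[ℂ] E) (lam : ℂ) :
    Set.range (T.graphSubScalar lam) = (LinearMap.range (T.subScalar lam) : Set E) := by
  ext y
  rw [SetLike.mem_coe, mem_range_subScalar_iff]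
  constructor
  · rintro ⟨p, rfl⟩
    exact ⟨p, p.2, rfl⟩
  · rintro ⟨p, hp, rfl⟩
    exact ⟨⟨p, hp⟩, rfl⟩

/-- The graph of the closure is the closure of the graph, so closed conditions on pairs pass from
Schwartz functions to the closed operator. -/
theorem graph_closure_induction {S : E →ₗ.[ℂ] E} (hS : S.IsClosable) {P : E × E → Prop}
    (hP : _root_.IsClosed {p | P p}) (h : ∀ u : S.domain, P (u, S u)) :
    ∀ p ∈ S.closure.graph, P p := by
  intro p hp
  rw [← hS.graph_closure_eq_closure_graph, ← SetLike.mem_coe,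
    Submodule.topologicalClosure_coe] at hp
  refine hP.closure_subset_iff.2 ?_ hp
  intro q hq
  obtain ⟨u, hu, hv⟩ := (S.mem_graph_iff).1 hq
  have := h u
  rw [hu, hv] at this
  exact this

theorem ker_subScalar_eq_bot {T : E →ₗ.[ℂ] E} {lam : ℂ} {c : ℝ}
    (hc : 0 < c) (h : ∀ p ∈ T.graph, c * ‖p.1‖ ≤ ‖p.2 - lam • p.1‖) :
    LinearMap.ker (T.subScalar lam) = ⊥ := by
  rw [LinearMap.ker_eq_bot']
  intro u hu
  have h1 := h _ (T.mem_graph u)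
  have h2 : T u - lam • (u : E) = 0 := hu
  dsimp only at h1
  rw [h2, norm_zero] at h1
  have : ‖(u : E)‖ ≤ 0 := by
    by_contra hcon
    push Not at hcon
    exact absurd h1 (not_le.2 (mul_pos hc hcon))
  exact Subtype.ext (norm_le_zero_iff.1 this)

variable [CompleteSpace E]

/-- Open mapping theorem for the bounded map `graphSubScalar` from the graph, a Banach space, onto
the closed range. -/
theorem exists_preimage_of_isClosed_range {T : E →ₗ.[ℂ] E} (hT : T.IsClosed) {lam : ℂ}
    (h : _root_.IsClosed (LinearMap.range (T.subScalar lam) : Set E)) :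
    ∃ C : ℝ, 0 < C ∧ ∀ p ∈ T.graph, ∃ q ∈ T.graph,
      q.2 - lam • q.1 = p.2 - lam • p.1 ∧ ‖q.1‖ ≤ C * ‖p.2 - lam • p.1‖ := by
  have : CompleteSpace T.graph := hT.completeSpace_coe
  have : CompleteSpace (LinearMap.range (T.subScalar lam)) := h.completeSpace_coe
  have hmem : ∀ p : T.graph, T.graphSubScalar lam p ∈ LinearMap.range (T.subScalar lam) := by
    intro p
    rw [← SetLike.mem_coe, ← range_graphSubScalar]
    exact ⟨p, rfl⟩
  let φ : T.graph →L[ℂ] LinearMap.range (T.subScalar lam) :=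
    (T.graphSubScalar lam).codRestrict _ hmem
  have hsurj : Function.Surjective φ := by
    rintro ⟨y, hy⟩
    rw [← SetLike.mem_coe, ← range_graphSubScalar] at hy
    obtain ⟨p, hp⟩ := hy
    exact ⟨p, Subtype.ext hp⟩
  obtain ⟨C, hC, hbound⟩ := φ.exists_preimage_norm_le hsurj
  refine ⟨C, hC, fun p hp => ?_⟩
  obtain ⟨q, hq, hle⟩ := hbound (φ ⟨p, hp⟩)
  refine ⟨q, q.2, congrArg Subtype.val hq, ?_⟩
  exact (norm_fst_le (q : E × E)).trans hle

theorem isClosed_range_of_bound {T : E →ₗ.[ℂ] E} (hT : T.IsClosed) {lam : ℂ} {c : ℝ}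
    (hc : 0 < c) (h : ∀ p ∈ T.graph, c * ‖p.1‖ ≤ ‖p.2 - lam • p.1‖) :
    _root_.IsClosed (LinearMap.range (T.subScalar lam) : Set E) := by
  have : CompleteSpace T.graph := hT.completeSpace_coe
  rw [← range_graphSubScalar]
  -- The term `1 / c` controls `‖u‖` and `1 + ‖lam‖ / c` controls `‖v‖`; their sum controls the
  -- maximum, which is the norm on the graph.
  have hanti : AntilipschitzWith (Real.toNNReal (1 / c + 1 + ‖lam‖ / c))
      (T.graphSubScalar lam) := by
    refine AddMonoidHomClass.antilipschitz_of_bound _ fun p => ?_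
    rw [Real.coe_toNNReal _ (by positivity)]
    obtain ⟨⟨u, v⟩, hp⟩ := p
    have h1 : c * ‖u‖ ≤ ‖v - lam • u‖ := h _ hp
    change ‖(u, v)‖ ≤ _ * ‖v - lam • u‖
    have h2 : ‖u‖ ≤ 1 / c * ‖v - lam • u‖ := by
      rw [one_div, ← div_eq_inv_mul, le_div_iff₀ hc, mul_comm]
      exact h1
    have h3 : ‖v‖ ≤ ‖v - lam • u‖ + ‖lam‖ * ‖u‖ := by
      calc ‖v‖ = ‖(v - lam • u) + lam • u‖ := by rw [sub_add_cancel]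
        _ ≤ _ := (norm_add_le _ _).trans (by rw [norm_smul])
    have h4 : ‖lam‖ * ‖u‖ ≤ ‖lam‖ / c * ‖v - lam • u‖ := by
      calc ‖lam‖ * ‖u‖ ≤ ‖lam‖ * (1 / c * ‖v - lam • u‖) := by gcongr
        _ = _ := by ring
    have h5 : 0 ≤ 1 / c * ‖v - lam • u‖ := by positivity
    have h6 : 0 ≤ ‖lam‖ / c * ‖v - lam • u‖ := by positivity
    have h7 := norm_nonneg (v - lam • u)
    rw [Prod.norm_def, add_mul, add_mul, one_mul]
    exact max_le (by dsimp only; linarith) (by dsimp only; linarith)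
  exact hanti.isClosed_range (T.graphSubScalar lam).uniformContinuous

end Banach

section EssentialSpectra

variable {E : Type*} [NormedAddCommGroup E] [NormedSpace ℂ E]

theorem isFredholmAt_of_bijective {T : E →ₗ.[ℂ] E} {lam : ℂ}
    (hker : LinearMap.ker (T.subScalar lam) = ⊥) (hrange : LinearMap.range (T.subScalar lam) = ⊤) :
    T.IsFredholmAt lam ∧ T.fredholmIndexAt lam = 0 := by
  have : Subsingleton (E ⧸ LinearMap.range (T.subScalar lam)) :=
    Submodule.Quotient.subsingleton_iff.2 hrange
  refine ⟨⟨?_, ?_, ?_⟩, ?_⟩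
  · rw [hker]; infer_instance
  · rw [hrange]; exact isClosed_univ
  · infer_instance
  · rw [fredholmIndexAt, hker, finrank_bot, Module.finrank_zero_of_subsingleton]
    simp

/-- A non-closed range rules out both Fredholm conditions, while bijectivity gives all of them with
index zero. -/
theorem essSpectra_eq_of_dichotomy {T : E →ₗ.[ℂ] E} {s : Set ℂ}
    (hs : ∀ lam ∈ s, ¬ _root_.IsClosed (LinearMap.range (T.subScalar lam) : Set E))
    (hker : ∀ lam ∉ s, LinearMap.ker (T.subScalar lam) = ⊥)
    (hrange : ∀ lam ∉ s, LinearMap.range (T.subScalar lam) = ⊤) :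
    T.essSpectrumDS = s ∧ T.essSpectrumWolf = s ∧ T.essSpectrumSchechter = s := by
  have hF : ∀ lam ∉ s, T.IsFredholmAt lam ∧ T.fredholmIndexAt lam = 0 := fun lam hlam =>
    isFredholmAt_of_bijective (hker lam hlam) (hrange lam hlam)
  refine ⟨Set.ext fun lam => ⟨fun h => ?_, hs lam⟩,
    Set.ext fun lam => ⟨fun h => ?_, fun h h' => hs lam h h'.closed_range⟩,
    Set.ext fun lam => ⟨fun h => ?_, fun h h' => hs lam h h'.1.closed_range⟩⟩
  · by_contra hlam
    exact h (hF lam hlam).1.closed_range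
  · by_contra hlam
    exact h (hF lam hlam).1
  · by_contra hlam
    exact h (hF lam hlam)

end EssentialSpectra

section Symmetric

variable {H : Type*} [NormedAddCommGroup H] [InnerProductSpace ℂ H]

/-- The numerical range lies in the half-line, which is at positive distance from `lam`;
Cauchy–Schwarz turns that distance into a lower bound. -/
theorem dist_bound_of_nonneg {S : H →ₗ.[ℂ] H}
    (hS : ∀ u : S.domain, ∃ r : ℝ, 0 ≤ r ∧ inner ℂ (u : H) (S u) = r) {lam : ℂ}
    (hlam : lam ∉ (fun r : ℝ => (r : ℂ)) '' Set.Ici 0) :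
    ∃ c : ℝ, 0 < c ∧ ∀ u : S.domain, c * ‖(u : H)‖ ≤ ‖S u - lam • (u : H)‖ := by
  obtain ⟨c, hc, hbound⟩ : ∃ c : ℝ, 0 < c ∧ ∀ r : ℝ, 0 ≤ r → c ≤ ‖(r : ℂ) - lam‖ := by
    by_cases him : lam.im = 0
    · have hre : lam.re < 0 := by
        by_contra hcon
        push Not at hcon
        exact hlam ⟨lam.re, hcon, Complex.ext (by simp) (by simp [him])⟩
      refine ⟨-lam.re, by linarith, fun r hr => ?_⟩
      refine le_trans ?_ (Complex.re_le_norm _)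
      simp only [Complex.sub_re, Complex.ofReal_re]
      linarith
    · refine ⟨|lam.im|, abs_pos.2 him, fun r hr => ?_⟩
      refine le_trans ?_ (Complex.abs_im_le_norm _)
      simp
  refine ⟨c, hc, fun u => ?_⟩
  obtain ⟨r, hr, hin⟩ := hS u
  rcases (norm_nonneg (u : H)).eq_or_lt' with h0 | h0
  · rw [h0, mul_zero]; exact norm_nonneg _
  have h1 : inner ℂ (u : H) (S u - lam • (u : H))
      = (((r / ‖(u : H)‖ ^ 2 : ℝ) : ℂ) - lam) * ((‖(u : H)‖ ^ 2 : ℝ) : ℂ) := by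
    rw [inner_sub_right, inner_smul_right, hin, inner_self_eq_norm_sq_to_K, sub_mul,
      ← Complex.ofReal_mul, div_mul_cancel₀ _ (by positivity)]
    simp
  have h2 := norm_inner_le_norm (𝕜 := ℂ) (u : H) (S u - lam • (u : H))
  rw [h1, norm_mul, Complex.norm_real, Real.norm_of_nonneg (by positivity)] at h2
  have h3 := mul_le_mul_of_nonneg_right (hbound (r / ‖(u : H)‖ ^ 2) (by positivity))
    (by positivity : 0 ≤ ‖(u : H)‖ ^ 2)
  have h4 : ‖(u : H)‖ * (c * ‖(u : H)‖) ≤ ‖(u : H)‖ * ‖S u - lam • (u : H)‖ := by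
    nlinarith
  exact le_of_mul_le_mul_left h4 h0

end Symmetric

end LinearPMap

/-! ### Schwartz functions of the form `exp (-h)`, and smooth cutoffs. -/

section ExpNeg

variable {E : Type*} [NormedAddCommGroup E] [NormedSpace ℝ E]

theorem exists_norm_pow_mul_iteratedFDeriv_exp_neg_le {h : E → ℝ} (hh : h.HasTemperateGrowth)
    {ε C : ℝ} (hε : 0 < ε) (hlow : ∀ x, ε * ‖x‖ - C ≤ h x) (k n : ℕ) :
    ∃ B : ℝ, ∀ x, ‖x‖ ^ k * ‖iteratedFDeriv ℝ n (fun x => Real.exp (-h x)) x‖ ≤ B := by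
  obtain ⟨m, D, hD0, hD⟩ := hh.neg.norm_iteratedFDeriv_le_uniform n
  have hder : ∀ x, ‖iteratedFDeriv ℝ n (fun x => Real.exp (-h x)) x‖ ≤
      n.factorial * Real.exp (-h x) * ((D + 1) * (1 + ‖x‖) ^ m) ^ n := by
    intro x
    refine norm_iteratedFDeriv_comp_le (N := ∞) Real.contDiff_exp hh.neg.1 (mod_cast le_top) x ?_ ?_
    · intro i _
      rw [norm_iteratedFDeriv_eq_norm_iteratedDeriv, iteratedDeriv_eq_iterate, Real.iter_deriv_exp,
        Real.norm_of_nonneg (Real.exp_pos _).le]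
      exact le_rfl
    · intro i hi hin
      -- The chain-rule estimate wants the `i`-th derivative bounded by an `i`-th power; with a base
      -- at least 1, the first power suffices for `i ≥ 1`.
      have h1 : 1 ≤ (D + 1) * (1 + ‖x‖) ^ m := by
        have : (1 : ℝ) ≤ (1 + ‖x‖) ^ m := one_le_pow₀ (by linarith [norm_nonneg x])
        nlinarith
      refine (hD i hin x).trans (le_trans ?_ (le_self_pow₀ h1 (by omega)))
      gcongr
      linarith
  set q := k + m * n
  refine ⟨n.factorial * (D + 1) ^ n * (q.factorial * Real.exp (ε + C) / ε ^ q), fun x => ?_⟩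
  have h2 : (1 + ‖x‖) ^ q * Real.exp (-h x) ≤ q.factorial * Real.exp (ε + C) / ε ^ q := by
    rw [le_div_iff₀ (by positivity)]
    have h3 := Real.pow_div_factorial_le_exp (x := ε * (1 + ‖x‖)) (by positivity) q
    rw [div_le_iff₀ (by positivity), mul_pow] at h3
    calc (1 + ‖x‖) ^ q * Real.exp (-h x) * ε ^ q
        = ε ^ q * (1 + ‖x‖) ^ q * Real.exp (-h x) := by ring
      _ ≤ (Real.exp (ε * (1 + ‖x‖)) * q.factorial) * Real.exp (C - ε * ‖x‖) := by
          gcongr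
          linarith [hlow x]
      _ = q.factorial * (Real.exp (ε * (1 + ‖x‖)) * Real.exp (C - ε * ‖x‖)) := by ring
      _ = _ := by
          rw [← Real.exp_add]
          ring_nf
  calc ‖x‖ ^ k * ‖iteratedFDeriv ℝ n (fun x => Real.exp (-h x)) x‖
      ≤ (1 + ‖x‖) ^ k * (n.factorial * Real.exp (-h x) * ((D + 1) * (1 + ‖x‖) ^ m) ^ n) := by
        gcongr
        · linarith
        · exact hder x
    _ = n.factorial * (D + 1) ^ n * ((1 + ‖x‖) ^ q * Real.exp (-h x)) := by
        rw [mul_pow, ← pow_mul, pow_add]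
        ring
    _ ≤ _ := by gcongr

/-- The function `exp (-h)`, for `h` of temperate growth that grows at least linearly, as a
Schwartz function. -/
noncomputable def SchwartzMap.expNeg (h : E → ℝ) (hh : h.HasTemperateGrowth)
    (hlow : ∃ ε C : ℝ, 0 < ε ∧ ∀ x, ε * ‖x‖ - C ≤ h x) : 𝓢(E, ℝ) where
  toFun x := Real.exp (-h x)
  smooth' := Real.contDiff_exp.comp hh.neg.1
  decay' k n := by
    obtain ⟨ε, C, hε, hlow⟩ := hlow
    exact exists_norm_pow_mul_iteratedFDeriv_exp_neg_le hh hε hlow k n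

theorem exists_schwartzMap_smul_exp_neg {a : E → ℂ} (ha : a.HasTemperateGrowth)
    {h : E → ℝ} (hh : h.HasTemperateGrowth)
    (hlow : ∃ ε C : ℝ, 0 < ε ∧ ∀ x, ε * ‖x‖ - C ≤ h x) :
    ∃ f : 𝓢(E, ℂ), ∀ x, f x = a x * (Real.exp (-h x) : ℝ) := by
  refine ⟨SchwartzMap.smulLeftCLM ℂ a (SchwartzMap.postcompCLM (𝕜 := ℝ) Complex.ofRealCLM
    (SchwartzMap.expNeg h hh hlow)), fun x => ?_⟩
  rw [SchwartzMap.smulLeftCLM_apply_apply ha]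
  rfl

end ExpNeg

section Cutoff

theorem exists_contDiff_cutoff {E : Type*} [NormedAddCommGroup E] [NormedSpace ℝ E]
    [FiniteDimensional ℝ E] {K U : Set E} (hK : IsCompact K) (hU : IsOpen U) (hKU : K ⊆ U) :
    ∃ χ : E → ℝ, ContDiff ℝ ∞ χ ∧ HasCompactSupport χ ∧ tsupport χ ⊆ U ∧
      (∀ x, 0 ≤ χ x ∧ χ x ≤ 1) ∧ ∀ x ∈ K, χ x = 1 := by
  obtain ⟨K', hK', hKK', hK'U⟩ := exists_compact_between hK hU hKU
  obtain ⟨χ, hχ, hrange, hsupp, hone⟩ := exists_contMDiff_support_eq_eq_one_iff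
    (modelWithCornersSelf ℝ E) (isOpen_interior (s := K')) hK.isClosed hKK'
  have hts : tsupport χ ⊆ K' := by
    rw [tsupport, hsupp]
    exact closure_minimal interior_subset hK'.isClosed
  exact ⟨χ, hχ.contDiff, hK'.of_isClosed_subset (isClosed_tsupport χ) hts, hts.trans hK'U,
    fun x => hrange ⟨x, rfl⟩, fun x hx => (hone x).1 hx⟩

end Cutoff

/-! ### The vector fields under the Fourier transform. -/

namespace Heisenberg

open scoped FourierTransform

/-- The space `ℂ × ℝ` with its Euclidean structure, on which the Fourier transform lives. -/
abbrev FreqSpace : Type := WithLp 2 (ℂ × ℝ)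

/-- The identification of the Heisenberg group with Euclidean space. -/
noncomputable def toFreqSpace : H3 ≃L[ℝ] FreqSpace :=
  (WithLp.prodContinuousLinearEquiv 2 ℝ ℂ ℝ).symm

theorem toFreqSpace_apply (p : H3) : toFreqSpace p = WithLp.toLp 2 p := rfl

theorem measurePreserving_toFreqSpace_symm : MeasurePreserving toFreqSpace.symm :=
  WithLp.volume_preserving_ofLp ℂ ℝ

/-- The inverse Fourier transform from Schwartz functions of the frequency to Schwartz functions
on the Heisenberg group. -/
noncomputable def invFourier : 𝓢(FreqSpace, ℂ) →ₗ[ℂ] 𝓢(H3, ℂ) :=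
  (compCLMOfContinuousLinearEquiv ℂ toFreqSpace).toLinearMap ∘ₗ
    (FourierTransform.fourierEquiv ℂ 𝓢(FreqSpace, ℂ)).symm.toLinearMap

theorem invFourier_eq (g : 𝓢(FreqSpace, ℂ)) :
    invFourier g = compCLMOfContinuousLinearEquiv ℂ toFreqSpace (𝓕⁻ g) := rfl

/-- Multiplication by the coordinate in the direction `m`. -/
noncomputable abbrev coordMul (m : FreqSpace) : 𝓢(FreqSpace, ℂ) →L[ℝ] 𝓢(FreqSpace, ℂ) :=
  smulLeftCLM ℂ (inner ℝ · m)

theorem coordMul_apply (m : FreqSpace) (g : 𝓢(FreqSpace, ℂ)) (x : FreqSpace) :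
    coordMul m g x = (inner ℝ x m : ℝ) * g x := by
  rw [coordMul, smulLeftCLM_apply_apply (by fun_prop)]
  simp

theorem lineDeriv_invFourier (v : H3) (g : 𝓢(FreqSpace, ℂ)) :
    ∂_{v} (invFourier g) =
      invFourier ((2 * Real.pi * Complex.I) • coordMul (toFreqSpace v) g) := by
  rw [invFourier_eq, lineDerivOp_compCLMOfContinuousLinearEquiv, lineDerivOp_fourierInv_eq,
    invFourier_eq]

/-- The factor `2πi` is kept on the left because multiplication by `b` always follows `∂/∂τ`, which
supplies it; no division is then needed. -/
theorem smulLeft_invFourier {b : H3 → ℝ} (v : H3)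
    (hb : ∀ p, b p = 2 * inner ℝ (toFreqSpace p) (toFreqSpace v))
    (hb' : (fun p => (b p : ℂ)).HasTemperateGrowth) (g : 𝓢(FreqSpace, ℂ)) :
    (2 * Real.pi * Complex.I) • smulLeftCLM ℂ (fun p => (b p : ℂ)) (invFourier g) =
      -(2 : ℂ) • invFourier (∂_{toFreqSpace v} g) := by
  have h := fourierInv_lineDerivOp_eq g (toFreqSpace v)
  rw [invFourier_eq, invFourier_eq, h]
  ext p
  simp only [smul_apply, smulLeftCLM_apply_apply hb', compCLMOfContinuousLinearEquiv_apply,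
    Function.comp_apply, smul_eq_mul]
  rw [smulLeftCLM_apply_apply (by fun_prop), hb]
  simp only [Complex.real_smul]
  push_cast
  ring

/-- The vector field `X` on the Fourier side. -/
noncomputable def freqX (g : 𝓢(FreqSpace, ℂ)) : 𝓢(FreqSpace, ℂ) :=
  (2 * Real.pi * Complex.I) • coordMul (toFreqSpace (1, 0)) g +
    (2 : ℂ) • ∂_{toFreqSpace (Complex.I, 0)} (coordMul (toFreqSpace (0, 1)) g)

/-- The vector field `Y` on the Fourier side. -/
noncomputable def freqY (g : 𝓢(FreqSpace, ℂ)) : 𝓢(FreqSpace, ℂ) :=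
  (2 * Real.pi * Complex.I) • coordMul (toFreqSpace (Complex.I, 0)) g -
    (2 : ℂ) • ∂_{toFreqSpace (1, 0)} (coordMul (toFreqSpace (0, 1)) g)

theorem fieldX_invFourier (g : 𝓢(FreqSpace, ℂ)) :
    fieldX (invFourier g) = invFourier (freqX g) := by
  have h := smulLeft_invFourier (b := fun p => 2 * p.1.im) (Complex.I, 0)
    (fun p => by simp [toFreqSpace_apply, WithLp.prod_inner_apply, Complex.inner])
    hasTemperateGrowth_im (coordMul (toFreqSpace (0, 1)) g)
  change ∂_{((1, 0) : H3)} (invFourier g) - smulLeftCLM ℂ (fun p : H3 => ((2 * p.1.im : ℝ) : ℂ))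
    (∂_{((0, 1) : H3)} (invFourier g)) = _
  rw [lineDeriv_invFourier, lineDeriv_invFourier, freqX, map_add, sub_eq_add_neg]
  congr 1
  rw [map_smul, map_smul, h, map_smul, neg_smul, neg_neg]

theorem fieldY_invFourier (g : 𝓢(FreqSpace, ℂ)) :
    fieldY (invFourier g) = invFourier (freqY g) := by
  have h := smulLeft_invFourier (b := fun p => 2 * p.1.re) (1, 0)
    (fun p => by simp [toFreqSpace_apply, WithLp.prod_inner_apply, Complex.inner])
    hasTemperateGrowth_re (coordMul (toFreqSpace (0, 1)) g)
  change ∂_{((Complex.I, 0) : H3)} (invFourier g) +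
    smulLeftCLM ℂ (fun p : H3 => ((2 * p.1.re : ℝ) : ℂ)) (∂_{((0, 1) : H3)} (invFourier g)) = _
  rw [lineDeriv_invFourier, lineDeriv_invFourier, freqY, map_sub, sub_eq_add_neg]
  congr 1
  rw [map_smul, map_smul, h, map_smul, neg_smul]

theorem freqX_linear (c d : ℂ) (f g : 𝓢(FreqSpace, ℂ)) :
    freqX (c • f + d • g) = c • freqX f + d • freqX g := by
  have h : ∀ (c : ℂ) (m) (f : 𝓢(FreqSpace, ℂ)), coordMul m (c • f) = c • coordMul m f := by
    intro c m f
    ext x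
    simp only [coordMul_apply, smul_apply, smul_eq_mul]
    ring
  simp only [freqX, map_add, h, LineDeriv.lineDerivOp_add, LineDeriv.lineDerivOp_smul]
  module

theorem freqY_linear (c d : ℂ) (f g : 𝓢(FreqSpace, ℂ)) :
    freqY (c • f + d • g) = c • freqY f + d • freqY g := by
  have h : ∀ (c : ℂ) (m) (f : 𝓢(FreqSpace, ℂ)), coordMul m (c • f) = c • coordMul m f := by
    intro c m f
    ext x
    simp only [coordMul_apply, smul_apply, smul_eq_mul]
    ring
  simp only [freqY, map_add, h, LineDeriv.lineDerivOp_add, LineDeriv.lineDerivOp_smul]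
  module

/-- The sub-Laplacian on the Fourier side, in terms of `X + iY` and `X - iY`. -/
theorem subLaplacianSchwartz_invFourier (g : 𝓢(FreqSpace, ℂ)) :
    subLaplacianSchwartz (invFourier g) = invFourier (-(2⁻¹ : ℂ) •
      ((freqX (freqX g + Complex.I • freqY g) - Complex.I • freqY (freqX g + Complex.I • freqY g)) +
      (freqX (freqX g - Complex.I • freqY g) +
        Complex.I • freqY (freqX g - Complex.I • freqY g)))) := by
  change -(fieldX (fieldX (invFourier g)) + fieldY (fieldY (invFourier g))) = _
  rw [fieldX_invFourier, fieldX_invFourier, fieldY_invFourier, fieldY_invFourier, ← map_add,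
    ← map_neg]
  congr 1
  have h1 := freqX_linear 1 Complex.I (freqX g) (freqY g)
  have h2 := freqY_linear 1 Complex.I (freqX g) (freqY g)
  have h3 := freqX_linear 1 (-Complex.I) (freqX g) (freqY g)
  have h4 := freqY_linear 1 (-Complex.I) (freqX g) (freqY g)
  simp only [one_smul, neg_smul, ← sub_eq_add_neg] at h1 h2 h3 h4
  rw [h1, h2, h3, h4]
  simp only [smul_add, smul_sub, smul_smul]
  rw [show -(2⁻¹ : ℂ) * (Complex.I * Complex.I) = 2⁻¹ by rw [Complex.I_mul_I]; ring]
  module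

/-- Transport of square-integrable functions to Euclidean space. -/
noncomputable def toFreqL2 : L2 →ₗᵢ[ℂ] Lp ℂ 2 (volume : Measure FreqSpace) :=
  Lp.compMeasurePreservingₗᵢ ℂ toFreqSpace.symm measurePreserving_toFreqSpace_symm

theorem toFreqL2_invFourier (g : 𝓢(FreqSpace, ℂ)) :
    toFreqL2 (schwartzIncl (invFourier g)) = 𝓕⁻ (g.toLp 2) := by
  rw [toLp_fourierInv_eq]
  have h := Lp.toLp_compMeasurePreserving ((invFourier g).memLp 2 (volume : Measure H3))
    measurePreserving_toFreqSpace_symm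
  refine Eq.trans h ?_
  refine MemLp.toLp_congr _ _ (Filter.Eventually.of_forall fun x => ?_)
  simp [invFourier_eq]

theorem fourier_toFreqL2_invFourier (g : 𝓢(FreqSpace, ℂ)) :
    𝓕 (toFreqL2 (schwartzIncl (invFourier g))) = g.toLp 2 := by
  rw [toFreqL2_invFourier, FourierTransform.fourier_fourierInv_eq]

theorem inner_schwartzIncl_invFourier (v : L2) (g : 𝓢(FreqSpace, ℂ)) :
    inner ℂ v (schwartzIncl (invFourier g)) =
      inner ℂ (𝓕 (toFreqL2 v)) (g.toLp 2 (volume : Measure FreqSpace)) := by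
  rw [← fourier_toFreqL2_invFourier, Lp.inner_fourier_eq, toFreqL2.inner_map_map]

theorem norm_schwartzIncl_invFourier (g : 𝓢(FreqSpace, ℂ)) :
    ‖schwartzIncl (invFourier g)‖ = ‖g.toLp 2 (volume : Measure FreqSpace)‖ := by
  rw [← fourier_toFreqL2_invFourier, Lp.norm_fourier_eq, toFreqL2.norm_map]

theorem eq_zero_of_fourier_toFreqL2_eq_zero {v : L2} (h : 𝓕 (toFreqL2 v) = 0) : v = 0 := by
  rw [← norm_eq_zero, ← toFreqL2.norm_map, ← Lp.norm_fourier_eq, h, norm_zero]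

end Heisenberg

/-! ### Test functions away from `μ = 0` and the Gaussian family `freqMap`. -/

theorem contDiff_of_contDiffAt_tsupport {E F : Type*} [NormedAddCommGroup E] [NormedSpace ℝ E]
    [NormedAddCommGroup F] [NormedSpace ℝ F] {n : WithTop ℕ∞} {f : E → F}
    (h : ∀ x ∈ tsupport f, ContDiffAt ℝ n f x) : ContDiff ℝ n f := by
  refine contDiff_iff_contDiffAt.2 fun x => ?_
  by_cases hx : x ∈ tsupport f
  · exact h x hx
  · exact contDiffAt_const.congr_of_eventuallyEq (notMem_tsupport_iff_eventuallyEq.1 hx)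

namespace Heisenberg

/-- Smooth functions with compact support in `ℝ \ {0}`. -/
structure IsTestFun (ψ : ℝ → ℂ) : Prop where
  contDiff : ContDiff ℝ ∞ ψ
  hasCompactSupport : HasCompactSupport ψ
  zero_notMem : (0 : ℝ) ∉ tsupport ψ

namespace IsTestFun

variable {ψ : ℝ → ℂ}

theorem apply_zero (hψ : IsTestFun ψ) : ψ 0 = 0 := image_eq_zero_of_notMem_tsupport hψ.zero_notMem

theorem mul_left (hψ : IsTestFun ψ) {m : ℝ → ℂ} (hm : ∀ t ∈ tsupport ψ, ContDiffAt ℝ ∞ m t) :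
    IsTestFun (fun t => m t * ψ t) where
  contDiff := by
    refine contDiff_of_contDiffAt_tsupport fun t ht => ?_
    have ht' : t ∈ tsupport ψ := tsupport_mul_subset_right ht
    exact (hm t ht').mul hψ.contDiff.contDiffAt
  hasCompactSupport := hψ.hasCompactSupport.mul_left
  zero_notMem := fun h => hψ.zero_notMem (tsupport_mul_subset_right h)

theorem mul_left_of_ne_zero (hψ : IsTestFun ψ) {m : ℝ → ℂ}
    (hm : ∀ t ≠ 0, ContDiffAt ℝ ∞ m t) : IsTestFun (fun t => m t * ψ t) :=
  hψ.mul_left fun t ht => hm t fun h => hψ.zero_notMem (h ▸ ht)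

end IsTestFun

theorem contDiffAt_ofReal_abs {t : ℝ} (ht : t ≠ 0) :
    ContDiffAt ℝ ∞ (fun t : ℝ => ((|t| : ℝ) : ℂ)) t :=
  Complex.ofRealCLM.contDiff.contDiffAt.comp t (contDiffAt_abs ht)

theorem contDiffAt_ofReal (t : ℝ) : ContDiffAt ℝ ∞ (fun t : ℝ => (t : ℂ)) t :=
  Complex.ofRealCLM.contDiff.contDiffAt

/-- The Gaussian coefficient `π/(2|t|)` is singular at 0 and decays at infinity. A cutoff
interpolates between it, where `ψ` lives, and the constant 1, giving a smooth coefficient bounded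
below. -/
theorem exists_width {ψ : ℝ → ℂ} (hψ : IsTestFun ψ) :
    ∃ θ : ℝ → ℝ, θ.HasTemperateGrowth ∧ (∃ δ : ℝ, 0 < δ ∧ ∀ t, δ ≤ θ t) ∧
      ∀ t, ψ t ≠ 0 → θ t = Real.pi / (2 * |t|) := by
  obtain ⟨χ, hχ, hcs, hts, h01, hone⟩ := exists_contDiff_cutoff hψ.hasCompactSupport
    (isOpen_compl_singleton (x := (0 : ℝ)))
    (fun t ht h => hψ.zero_notMem (by rw [Set.mem_singleton_iff] at h; exact h ▸ ht))
  have hsm : ContDiff ℝ ∞ (fun t => χ t * (Real.pi / (2 * |t|) - 1)) := by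
    refine contDiff_of_contDiffAt_tsupport fun t ht => ?_
    have ht0 : t ≠ 0 := hts (tsupport_mul_subset_left ht)
    exact hχ.contDiffAt.mul ((contDiffAt_const.div (contDiffAt_const.mul (contDiffAt_abs ht0))
      (by simpa using ht0)).sub contDiffAt_const)
  have htemp := hcs.mul_right (f' := fun t => Real.pi / (2 * |t|) - 1) |>.hasTemperateGrowth hsm
  have hθ : (fun t => 1 + χ t * (Real.pi / (2 * |t|) - 1)).HasTemperateGrowth :=
    (Function.HasTemperateGrowth.const (1 : ℝ)).add htemp
  refine ⟨fun t => 1 + χ t * (Real.pi / (2 * |t|) - 1), hθ, ?_, fun t ht => ?_⟩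
  · have hpos : ∀ t ∈ tsupport χ, 0 < 1 + χ t * (Real.pi / (2 * |t|) - 1) := by
      intro t ht
      have ht0 : 0 < |t| := abs_pos.2 (hts ht)
      have hk : 0 < Real.pi / (2 * |t|) := by have := Real.pi_pos; positivity
      obtain ⟨h0, h1⟩ := h01 t
      rcases h1.eq_or_lt with h1 | h1
      · rw [h1]; linarith
      · nlinarith [mul_nonneg h0 hk.le]
    obtain ⟨δ, hδ, hle⟩ := IsCompact.exists_forall_le' hcs hθ.1.continuous.continuousOn hpos
    refine ⟨min δ 1, lt_min hδ one_pos, fun t => ?_⟩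
    by_cases ht : t ∈ tsupport χ
    · exact (min_le_left _ _).trans (hle t ht)
    · simp [image_eq_zero_of_notMem_tsupport ht]
  · dsimp only
    rw [hone t (subset_tsupport ψ ht)]
    ring

theorem norm_sq_freqSpace (x : FreqSpace) : ‖x‖ ^ 2 = ‖x.fst‖ ^ 2 + x.snd ^ 2 := by
  rw [WithLp.prod_norm_sq_eq_of_L2]
  simp

/-- The tilt `l` is zero for `freqMap`; nonzero tilts supply the exponential moments needed for
density. -/
theorem exists_freqMap {ψ : ℝ → ℂ} (hψ : IsTestFun ψ) (a b : ℕ) (l : FreqSpace →L[ℝ] ℝ) :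
    ∃ f : 𝓢(FreqSpace, ℂ), ∀ x, f x = x.fst ^ a * (starRingEnd ℂ x.fst) ^ b *
      (Real.exp (-(Real.pi / (2 * |x.snd|) * ‖x.fst‖ ^ 2) - l x) : ℝ) * ψ x.snd := by
  obtain ⟨θ, hθ, ⟨δ, hδ, hle⟩, hθψ⟩ := exists_width hψ
  let pf : FreqSpace →L[ℝ] ℂ := WithLp.fstL 2 ℝ ℂ ℝ
  let ps : FreqSpace →L[ℝ] ℝ := WithLp.sndL 2 ℝ ℂ ℝ
  have hpf : (fun x => pf x).HasTemperateGrowth := pf.hasTemperateGrowth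
  have hps : (fun x => ps x).HasTemperateGrowth := ps.hasTemperateGrowth
  have hconj : (fun x => (starRingEnd ℂ) (pf x)).HasTemperateGrowth :=
    (Complex.conjCLE.toContinuousLinearMap.comp pf).hasTemperateGrowth
  -- The exponent must also grow in `μ`, so `μ²` is added to it and this factor compensates.
  have hψ' : IsTestFun (fun t => (Real.exp (t ^ 2) : ℂ) * ψ t) :=
    hψ.mul_left fun t _ => Complex.ofRealCLM.contDiff.contDiffAt.comp t
      (Real.contDiff_exp.comp (contDiff_id.pow 2)).contDiffAt
  have hamp : (fun x => pf x ^ a * (starRingEnd ℂ (pf x)) ^ b *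
      ((Real.exp (ps x ^ 2) : ℂ) * ψ (ps x))).HasTemperateGrowth :=
    ((hpf.pow a).mul (hconj.pow b)).mul
      ((hψ'.hasCompactSupport.hasTemperateGrowth hψ'.contDiff).comp hps)
  have hh : (fun x => θ (ps x) * ‖pf x‖ ^ 2 + ps x ^ 2 + l x).HasTemperateGrowth :=
    (((hθ.comp hps).mul ((Function.hasTemperateGrowth_norm_sq (H := ℂ)).comp hpf)).add
      (hps.pow 2)).add l.hasTemperateGrowth
  have hlow : ∃ ε C : ℝ, 0 < ε ∧ ∀ x, ε * ‖x‖ - C ≤ θ (ps x) * ‖pf x‖ ^ 2 + ps x ^ 2 + l x := by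
    have hδ' : 0 < min δ 1 := lt_min hδ one_pos
    -- The constant is the maximum of `(‖l‖ + 1)s - min δ 1 * s²` over real `s`.
    refine ⟨1, (‖l‖ + 1) ^ 2 / (4 * min δ 1), one_pos, fun x => ?_⟩
    have h1 : min δ 1 * ‖x‖ ^ 2 ≤ θ (ps x) * ‖pf x‖ ^ 2 + ps x ^ 2 := by
      have e : ‖x‖ ^ 2 = ‖pf x‖ ^ 2 + ps x ^ 2 := norm_sq_freqSpace x
      rw [e, mul_add]
      gcongr
      · exact (min_le_left _ _).trans (hle _)
      · exact mul_le_of_le_one_left (sq_nonneg _) (min_le_right _ _)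
    have h2 : -(‖l‖ * ‖x‖) ≤ l x := neg_le_of_abs_le (l.le_opNorm x)
    have h3 : (‖l‖ + 1) * ‖x‖ - min δ 1 * ‖x‖ ^ 2 ≤ (‖l‖ + 1) ^ 2 / (4 * min δ 1) := by
      rw [le_div_iff₀ (by positivity)]
      nlinarith [sq_nonneg (2 * min δ 1 * ‖x‖ - (‖l‖ + 1))]
    linarith
  obtain ⟨f, hf⟩ := exists_schwartzMap_smul_exp_neg hamp hh hlow
  refine ⟨f, fun x => ?_⟩
  rw [hf]
  change x.fst ^ a * (starRingEnd ℂ x.fst) ^ b *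
    ((Real.exp (x.snd ^ 2) : ℂ) * ψ x.snd) *
      ((Real.exp (-(θ x.snd * ‖x.fst‖ ^ 2 + x.snd ^ 2 + l x)) : ℝ) : ℂ) = _
  by_cases h0 : ψ x.snd = 0
  · simp [h0]
  · rw [hθψ _ h0, show -(Real.pi / (2 * |x.snd|) * ‖x.fst‖ ^ 2) - l x =
      x.snd ^ 2 + -(Real.pi / (2 * |x.snd|) * ‖x.fst‖ ^ 2 + x.snd ^ 2 + l x) by ring,
      Real.exp_add]
    push_cast
    ring

/-- The function `ξ ^ a * conj ξ ^ b * exp (-π |ξ|² / (2 |μ|)) * ψ μ` of the frequency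
`(ξ, μ)`. -/
noncomputable def freqMap (a b : ℕ) {ψ : ℝ → ℂ} (hψ : IsTestFun ψ) : 𝓢(FreqSpace, ℂ) :=
  (exists_freqMap hψ a b 0).choose

theorem freqMap_apply (a b : ℕ) {ψ : ℝ → ℂ} (hψ : IsTestFun ψ) (x : FreqSpace) :
    freqMap a b hψ x = x.fst ^ a * (starRingEnd ℂ x.fst) ^ b *
      (Real.exp (-(Real.pi / (2 * |x.snd|) * ‖x.fst‖ ^ 2)) : ℝ) * ψ x.snd := by
  refine ((exists_freqMap hψ a b 0).choose_spec x).trans ?_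
  simp

end Heisenberg

/-! ### Ladder operators and the triangular action of the sub-Laplacian. -/

namespace Heisenberg

theorem hasDerivAt_pow_mul_conj_pow_mul_exp (a b : ℕ) (κ : ℝ) (z v : ℂ) :
    HasDerivAt (fun t : ℝ => (z + t * v) ^ a * (starRingEnd ℂ (z + t * v)) ^ b *
        ((Real.exp (-(κ * ‖z + t * v‖ ^ 2)) : ℝ) : ℂ))
      ((a * z ^ (a - 1) * v * (starRingEnd ℂ z) ^ b +
        b * z ^ a * (starRingEnd ℂ z) ^ (b - 1) * starRingEnd ℂ v -
        κ * (z * starRingEnd ℂ v + starRingEnd ℂ z * v) * z ^ a * (starRingEnd ℂ z) ^ b) *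
        ((Real.exp (-(κ * ‖z‖ ^ 2)) : ℝ) : ℂ)) 0 := by
  have h1 : HasDerivAt (fun t : ℝ => z + t * v) v 0 := by
    simpa using ((Complex.ofRealCLM.hasDerivAt (x := (0 : ℝ))).mul_const v).const_add z
  have h2 : HasDerivAt (fun t : ℝ => starRingEnd ℂ (z + t * v)) (starRingEnd ℂ v) 0 := by
    simpa using ((Complex.ofRealCLM.hasDerivAt (x := (0 : ℝ))).mul_const
      (starRingEnd ℂ v)).const_add (starRingEnd ℂ z)
  have h3 := ((h1.mul h2).const_mul (-(κ : ℂ))).cexp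
  have h4 := ((h1.pow a).mul (h2.pow b)).mul h3
  refine (h4.congr_deriv ?_).congr_of_eventuallyEq (Filter.Eventually.of_forall fun t => ?_)
  · simp only [Pi.mul_apply, Pi.pow_apply, Complex.ofReal_zero, zero_mul, add_zero,
      Complex.ofReal_exp, Complex.mul_conj, Complex.normSq_eq_norm_sq]
    push_cast
    rw [neg_mul]
    ring
  · simp only [Pi.mul_apply, Pi.pow_apply, Complex.ofReal_exp, Complex.mul_conj,
      Complex.normSq_eq_norm_sq]
    push_cast
    rw [neg_mul]

theorem lineDeriv_freqMap (a b : ℕ) {ψ : ℝ → ℂ} (hψ : IsTestFun ψ) (v : ℂ) (x : FreqSpace) :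
    (∂_{toFreqSpace (v, 0)} (freqMap a b hψ)) x =
      (a * x.fst ^ (a - 1) * v * (starRingEnd ℂ x.fst) ^ b +
        b * x.fst ^ a * (starRingEnd ℂ x.fst) ^ (b - 1) * starRingEnd ℂ v -
        ((Real.pi / (2 * |x.snd|) : ℝ) : ℂ) * (x.fst * starRingEnd ℂ v + starRingEnd ℂ x.fst * v) *
          x.fst ^ a * (starRingEnd ℂ x.fst) ^ b) *
        (Real.exp (-(Real.pi / (2 * |x.snd|) * ‖x.fst‖ ^ 2)) : ℝ) * ψ x.snd := by
  rw [lineDerivOp_apply, lineDeriv]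
  have h := (hasDerivAt_pow_mul_conj_pow_mul_exp a b (Real.pi / (2 * |x.snd|)) x.fst v).mul_const
    (ψ x.snd)
  rw [← h.deriv]
  congr 1
  ext t
  rw [freqMap_apply]
  have h1 : (x + t • toFreqSpace (v, 0)).fst = x.fst + t * v := by
    simp [toFreqSpace_apply]
  have h2 : (x + t • toFreqSpace (v, 0)).snd = x.snd := by
    simp [toFreqSpace_apply]
  rw [h1, h2]

theorem inner_toFreqSpace (x : FreqSpace) (p : H3) :
    inner ℝ x (toFreqSpace p) = x.fst.re * p.1.re + x.fst.im * p.1.im + x.snd * p.2 := by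
  rw [toFreqSpace_apply, WithLp.prod_inner_apply]
  change inner ℝ x.fst p.1 + inner ℝ x.snd p.2 = _
  rw [Complex.inner]
  simp
  ring

theorem coordMul_freqMap (a b : ℕ) {ψ : ℝ → ℂ} (hψ : IsTestFun ψ) :
    coordMul (toFreqSpace (0, 1)) (freqMap a b hψ) =
      freqMap a b (hψ.mul_left fun t _ => contDiffAt_ofReal t) := by
  ext x
  rw [coordMul_apply, inner_toFreqSpace, freqMap_apply, freqMap_apply]
  simp
  ring

/-- The complex vector field `X + iY` on the Fourier side. -/
noncomputable def freqXAddIY (g : 𝓢(FreqSpace, ℂ)) : 𝓢(FreqSpace, ℂ) :=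
  freqX g + Complex.I • freqY g

/-- The complex vector field `X - iY` on the Fourier side. -/
noncomputable def freqXSubIY (g : 𝓢(FreqSpace, ℂ)) : 𝓢(FreqSpace, ℂ) :=
  freqX g - Complex.I • freqY g

theorem freqXAddIY_linear (c d : ℂ) (f g : 𝓢(FreqSpace, ℂ)) :
    freqXAddIY (c • f + d • g) = c • freqXAddIY f + d • freqXAddIY g := by
  simp only [freqXAddIY, freqX_linear, freqY_linear]
  module

theorem freqXSubIY_linear (c d : ℂ) (f g : 𝓢(FreqSpace, ℂ)) :
    freqXSubIY (c • f + d • g) = c • freqXSubIY f + d • freqXSubIY g := by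
  simp only [freqXSubIY, freqX_linear, freqY_linear]
  module

theorem contDiffAt_sign {t : ℝ} (ht : t ≠ 0) :
    ContDiffAt ℝ ∞ (fun t : ℝ => (t : ℂ) / ((|t| : ℝ) : ℂ)) t := by
  simp only [div_eq_mul_inv]
  exact (contDiffAt_ofReal t).mul ((contDiffAt_ofReal_abs ht).inv (by simpa using ht))

theorem contDiffAt_one_add_sign {t : ℝ} (ht : t ≠ 0) :
    ContDiffAt ℝ ∞ (fun t : ℝ => 1 + (t : ℂ) / ((|t| : ℝ) : ℂ)) t :=
  contDiffAt_const.add (contDiffAt_sign ht)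

theorem contDiffAt_one_sub_sign {t : ℝ} (ht : t ≠ 0) :
    ContDiffAt ℝ ∞ (fun t : ℝ => 1 - (t : ℂ) / ((|t| : ℝ) : ℂ)) t :=
  contDiffAt_const.sub (contDiffAt_sign ht)

/-- Differentiating the Gaussian produces `ξ` times the sign of `μ`, which joins the multiplication
term to give `1 + sgn μ`. Differentiating the power of `conj ξ` gives the lowering term. -/
theorem freqXAddIY_freqMap (a b : ℕ) {ψ : ℝ → ℂ} (hψ : IsTestFun ψ) :
    freqXAddIY (freqMap a b hψ) =
      (2 * Real.pi * Complex.I) •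
        freqMap (a + 1) b (hψ.mul_left_of_ne_zero fun _ ht => contDiffAt_one_add_sign ht) +
      (-(4 * Complex.I * b)) •
        freqMap a (b - 1) (hψ.mul_left fun t _ => contDiffAt_ofReal t) := by
  ext x
  rw [freqXAddIY, freqX, freqY, coordMul_freqMap]
  simp only [add_apply, sub_apply, smul_apply, coordMul_apply, lineDeriv_freqMap, freqMap_apply,
    inner_toFreqSpace, smul_eq_mul, map_one, Complex.conj_I]
  have hz : (x.fst : ℂ) = (x.fst.re : ℂ) + (x.fst.im : ℂ) * Complex.I := (Complex.re_add_im _).symm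
  simp only [Complex.one_re, Complex.one_im, Complex.I_re, Complex.I_im, mul_one, mul_zero,
    add_zero, zero_add]
  push_cast
  -- At `μ = 0` the quotients take default values, harmless because `ψ 0 = 0`.
  rcases eq_or_ne x.snd 0 with h0 | h0
  · simp [h0, hψ.apply_zero]
  have h1 : (2 : ℂ) * ((Real.pi / (2 * (|x.snd| : ℝ)) : ℂ)) * x.snd =
    Real.pi * ((x.snd : ℂ) / (|x.snd| : ℝ)) := by
      have : ((|x.snd| : ℝ) : ℂ) ≠ 0 := by simpa using h0
      field_simp
  have hI := Complex.I_mul_I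
  set E : ℂ := Complex.exp (-((Real.pi : ℂ) / (2 * (|x.snd| : ℝ)) * ‖x.fst‖ ^ 2))
  set κ : ℂ := (Real.pi : ℂ) / (2 * (|x.snd| : ℝ))
  set s : ℂ := (x.snd : ℂ) / (|x.snd| : ℝ)
  set P := x.fst ^ a * (starRingEnd ℂ x.fst) ^ b * E * ψ x.snd with hP
  have e1 : (2 * Real.pi * Complex.I) * ((x.fst.re : ℂ) + x.fst.im * Complex.I) * P =
      (2 * Real.pi * Complex.I) * x.fst * P := by rw [← hz]
  rw [hP] at e1
  rw [pow_succ]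
  linear_combination e1 +
    (2 * Complex.I * x.fst ^ (a + 1) * (starRingEnd ℂ x.fst) ^ b * E * ψ x.snd) * h1

theorem freqXSubIY_freqMap (a b : ℕ) {ψ : ℝ → ℂ} (hψ : IsTestFun ψ) :
    freqXSubIY (freqMap a b hψ) =
      (2 * Real.pi * Complex.I) •
        freqMap a (b + 1) (hψ.mul_left_of_ne_zero fun _ ht => contDiffAt_one_sub_sign ht) +
      (4 * Complex.I * a) •
        freqMap (a - 1) b (hψ.mul_left fun t _ => contDiffAt_ofReal t) := by
  ext x
  rw [freqXSubIY, freqX, freqY, coordMul_freqMap]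
  simp only [add_apply, sub_apply, smul_apply, coordMul_apply, lineDeriv_freqMap, freqMap_apply,
    inner_toFreqSpace, smul_eq_mul, map_one, Complex.conj_I]
  have hz : starRingEnd ℂ x.fst = (x.fst.re : ℂ) - (x.fst.im : ℂ) * Complex.I := by
    apply Complex.ext <;> simp
  simp only [Complex.one_re, Complex.one_im, Complex.I_re, Complex.I_im, mul_one, mul_zero,
    add_zero, zero_add]
  push_cast
  rcases eq_or_ne x.snd 0 with h0 | h0
  · simp [h0, hψ.apply_zero]
  have h1 : (2 : ℂ) * ((Real.pi / (2 * (|x.snd| : ℝ)) : ℂ)) * x.snd =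
    Real.pi * ((x.snd : ℂ) / (|x.snd| : ℝ)) := by
      have : ((|x.snd| : ℝ) : ℂ) ≠ 0 := by simpa using h0
      field_simp
  set E : ℂ := Complex.exp (-((Real.pi : ℂ) / (2 * (|x.snd| : ℝ)) * ‖x.fst‖ ^ 2))
  set κ : ℂ := (Real.pi : ℂ) / (2 * (|x.snd| : ℝ))
  set s : ℂ := (x.snd : ℂ) / (|x.snd| : ℝ)
  set P := x.fst ^ a * (starRingEnd ℂ x.fst) ^ b * E * ψ x.snd with hP
  have e1 : (2 * Real.pi * Complex.I) * ((x.fst.re : ℂ) - x.fst.im * Complex.I) * P =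
      (2 * Real.pi * Complex.I) * starRingEnd ℂ x.fst * P := by rw [← hz]
  rw [hP] at e1
  rw [pow_succ]
  linear_combination e1 -
    (2 * Complex.I * x.fst ^ a * (starRingEnd ℂ x.fst) ^ (b + 1) * E * ψ x.snd) * h1

/-- The eigenvalues of the sub-Laplacian on the Fourier side. -/
noncomputable def level (a b : ℕ) (t : ℝ) : ℝ :=
  8 * Real.pi * (|t| * (a + b + 1) + t * (a - b))

theorem level_zero_zero (t : ℝ) : level 0 0 t = 8 * Real.pi * |t| := by
  simp [level]

theorem level_nonneg (a b : ℕ) (t : ℝ) : 0 ≤ level a b t := by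
  have h1 : |t * (a - b)| ≤ |t| * (a + b) := by
    rw [abs_mul]
    gcongr
    exact abs_sub_le_iff.2 ⟨by linarith [(Nat.cast_nonneg b : (0 : ℝ) ≤ b)],
      by linarith [(Nat.cast_nonneg a : (0 : ℝ) ≤ a)]⟩
  have h2 := (abs_le.1 h1).1
  have h3 := abs_nonneg t
  have := Real.pi_pos
  exact mul_nonneg (by positivity) (by linarith)

theorem contDiffAt_level (a b : ℕ) {t : ℝ} (ht : t ≠ 0) :
    ContDiffAt ℝ ∞ (fun t : ℝ => (level a b t : ℂ)) t :=
  Complex.ofRealCLM.contDiff.contDiffAt.comp t (contDiffAt_const.mul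
    (((contDiffAt_abs ht).mul contDiffAt_const).add (contDiffAt_id.mul contDiffAt_const)))

theorem subLaplacianSchwartz_invFourier_freqMap (a b : ℕ) {ψ : ℝ → ℂ} (hψ : IsTestFun ψ) :
    subLaplacianSchwartz (invFourier (freqMap a b hψ)) =
      invFourier (freqMap a b (hψ.mul_left_of_ne_zero fun _ ht => contDiffAt_level a b ht) -
        (16 * a * b : ℂ) • freqMap (a - 1) (b - 1)
          (hψ.mul_left fun t _ => (contDiffAt_ofReal t).pow 2)) := by
  rw [subLaplacianSchwartz_invFourier]
  congr 1
  change -(2⁻¹ : ℂ) • (freqXSubIY (freqXAddIY (freqMap a b hψ)) +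
    freqXAddIY (freqXSubIY (freqMap a b hψ))) = _
  simp only [freqXAddIY_freqMap, freqXSubIY_freqMap, freqXSubIY_linear, freqXAddIY_linear]
  ext x
  simp only [add_apply, sub_apply, smul_apply, freqMap_apply, smul_eq_mul]
  set E : ℂ := ((Real.exp (-(Real.pi / (2 * |x.snd|) * ‖x.fst‖ ^ 2)) : ℝ) : ℂ)
  rcases eq_or_ne x.snd 0 with h0 | h0
  · simp [h0, hψ.apply_zero]
  have ht : (x.snd : ℂ) ≠ 0 := by simpa using h0
  simp only [level]
  generalize (starRingEnd ℂ) x.fst = w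
  generalize x.fst = z
  have hI : Complex.I ^ 2 = -1 := Complex.I_sq
  rcases lt_or_gt_of_ne h0 with hneg | hpos
  · rw [abs_of_neg hneg]
    push_cast
    rw [div_neg, div_self ht]
    -- The truncated indices `a - 1` and `b - 1` become genuine predecessors, or else carry a zero
    -- coefficient.
    rcases a with _ | a <;> rcases b with _ | b <;>
      simp only [Nat.cast_zero, Nat.cast_succ, Nat.add_sub_cancel, pow_succ, pow_zero] <;>
      ring_nf <;> simp only [hI] <;> ring
  · rw [abs_of_pos hpos]
    push_cast
    rw [div_self ht]
    rcases a with _ | a <;> rcases b with _ | b <;>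
      simp only [Nat.cast_zero, Nat.cast_succ, Nat.add_sub_cancel, pow_succ, pow_zero] <;>
      ring_nf <;> simp only [hI] <;> ring

end Heisenberg

/-! ### Density of the span of the functions `freqMap a b ψ`. -/

section FourierInjective

open scoped FourierTransform

variable {V : Type*} [NormedAddCommGroup V] [InnerProductSpace ℝ V] [FiniteDimensional ℝ V]
  [MeasurableSpace V] [BorelSpace V]

/-- A test function is the Fourier transform of a Schwartz function, so its pairing with `h` moves
the transform onto `h` and vanishes. -/
theorem ae_eq_zero_of_fourier_eq_zero {h : V → ℂ} (hh : Integrable h) (h0 : ∀ y, 𝓕 h y = 0) :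
    ∀ᵐ x, h x = 0 := by
  refine ae_eq_zero_of_integral_contDiff_smul_eq_zero hh.locallyIntegrable fun g hg hgc => ?_
  have hcs : HasCompactSupport (fun x => (g x : ℂ)) :=
    hgc.comp_left (g := fun r : ℝ => (r : ℂ)) Complex.ofReal_zero
  have hsm : ContDiff ℝ ∞ (fun x => (g x : ℂ)) := Complex.ofRealCLM.contDiff.comp hg
  let φ : 𝓢(V, ℂ) := hcs.toSchwartzMap hsm
  let φ' : 𝓢(V, ℂ) := 𝓕⁻ φ
  have key := VectorFourier.integral_fourierIntegral_smul_eq_flip (L := innerₗ V)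
    Real.continuous_fourierChar continuous_inner φ'.integrable hh (μ := volume) (ν := volume)
  have h1 : ∀ x, VectorFourier.fourierIntegral Real.fourierChar volume (innerₗ V) φ' x =
      (g x : ℂ) := by
    intro x
    have : 𝓕 φ' = φ := FourierTransform.fourier_fourierInv_eq φ
    exact DFunLike.congr_fun this x
  have h2 : ∀ x, VectorFourier.fourierIntegral Real.fourierChar volume (innerₗ V).flip h x = 0 := by
    intro x
    rw [flip_innerₗ]
    exact h0 x
  simp only [h1, h2, smul_zero, integral_zero] at key
  rw [← key]
  rfl

end FourierInjective

namespace Heisenberg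

open scoped FourierTransform

/-- The span of the functions `freqMap a b ψ`. -/
noncomputable def freqSpan : Submodule ℂ 𝓢(FreqSpace, ℂ) :=
  Submodule.span ℂ {g | ∃ (a b : ℕ) (ψ : ℝ → ℂ) (hψ : IsTestFun ψ), g = freqMap a b hψ}

theorem freqMap_mem_freqSpan (a b : ℕ) {ψ : ℝ → ℂ} (hψ : IsTestFun ψ) :
    freqMap a b hψ ∈ freqSpan :=
  Submodule.subset_span ⟨a, b, ψ, hψ, rfl⟩

theorem coordMul_mem_freqSpan (w : ℂ) {g : 𝓢(FreqSpace, ℂ)} (hg : g ∈ freqSpan) :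
    coordMul (toFreqSpace (w, 0)) g ∈ freqSpan := by
  induction hg using Submodule.span_induction with
  | mem g hg =>
    obtain ⟨a, b, ψ, hψ, rfl⟩ := hg
    have : coordMul (toFreqSpace (w, 0)) (freqMap a b hψ) =
        (starRingEnd ℂ w / 2) • freqMap (a + 1) b hψ + (w / 2) • freqMap a (b + 1) hψ := by
      ext x
      have h1 : ((inner ℝ x (toFreqSpace (w, 0)) : ℝ) : ℂ) =
          starRingEnd ℂ w / 2 * x.fst + w / 2 * starRingEnd ℂ x.fst := by
        rw [inner_toFreqSpace]
        apply Complex.ext <;> simp <;> ring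
      simp only [coordMul_apply, h1, add_apply, smul_apply, freqMap_apply, smul_eq_mul]
      ring
    rw [this]
    exact freqSpan.add_mem (freqSpan.smul_mem _ (freqMap_mem_freqSpan _ _ _))
      (freqSpan.smul_mem _ (freqMap_mem_freqSpan _ _ _))
  | zero => rw [map_zero]; exact freqSpan.zero_mem
  | add f g _ _ hf hg => rw [map_add]; exact freqSpan.add_mem hf hg
  | smul c g _ hg =>
    have : coordMul (toFreqSpace (w, 0)) (c • g) = c • coordMul (toFreqSpace (w, 0)) g := by
      ext x
      simp only [coordMul_apply, smul_apply, smul_eq_mul]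
      ring
    rw [this]
    exact freqSpan.smul_mem c hg

theorem exists_freqSpan_eq_inner_pow_mul (w : ℂ) {ψ : ℝ → ℂ} (hψ : IsTestFun ψ) (n : ℕ) :
    ∃ g ∈ freqSpan, ∀ x,
      g x = ((inner ℝ x (toFreqSpace (w, 0)) : ℝ) : ℂ) ^ n * freqMap 0 0 hψ x := by
  induction n with
  | zero => exact ⟨_, freqMap_mem_freqSpan 0 0 hψ, fun x => by simp⟩
  | succ n ih =>
    obtain ⟨g, hg, hgx⟩ := ih
    refine ⟨_, coordMul_mem_freqSpan w hg, fun x => ?_⟩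
    rw [coordMul_apply, hgx, pow_succ]
    ring

variable {v : Lp ℂ 2 (volume : Measure FreqSpace)}

theorem inner_toLp_eq_integral (v : Lp ℂ 2 (volume : Measure FreqSpace)) (g : 𝓢(FreqSpace, ℂ)) :
    inner ℂ v (g.toLp 2) = ∫ x, starRingEnd ℂ (v x) * g x := by
  rw [L2.inner_def]
  refine integral_congr_ae ?_
  filter_upwards [g.coeFn_toLp 2 (volume : Measure FreqSpace)] with x hx
  rw [hx, RCLike.inner_apply']

theorem integrable_conj_mul (v : Lp ℂ 2 (volume : Measure FreqSpace)) (g : 𝓢(FreqSpace, ℂ)) :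
    Integrable (fun x => starRingEnd ℂ (v x) * g x) :=
  (Lp.memLp v).star.integrable_mul (g.memLp 2)

/-- The bound `exp |s| ≤ exp s + exp (-s)` reduces this to two tilted Gaussians, still Schwartz and
hence integrable against `v`. -/
theorem integrable_norm_mul_exp (v : Lp ℂ 2 (volume : Measure FreqSpace)) (w : ℂ)
    {ψ : ℝ → ℂ} (hψ : IsTestFun ψ) :
    Integrable (fun x => ‖starRingEnd ℂ (v x) * freqMap 0 0 hψ x‖ *
      Real.exp (2 * Real.pi * |inner ℝ x (toFreqSpace (w, 0))|)) := by
  let l : FreqSpace →L[ℝ] ℝ := (2 * Real.pi) • innerSL ℝ (toFreqSpace (w, 0))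
  have hl : ∀ x, l x = 2 * Real.pi * inner ℝ x (toFreqSpace (w, 0)) := by
    intro x
    rw [real_inner_comm]
    rfl
  obtain ⟨f₁, hf₁⟩ := exists_freqMap hψ 0 0 l
  obtain ⟨f₂, hf₂⟩ := exists_freqMap hψ 0 0 (-l)
  have hint := (integrable_conj_mul v f₁).norm.add (integrable_conj_mul v f₂).norm
  refine hint.mono ?_ (Filter.Eventually.of_forall fun x => ?_)
  · exact (integrable_conj_mul v (freqMap 0 0 hψ)).norm.aestronglyMeasurable.mul
      (Continuous.aestronglyMeasurable (by fun_prop))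
  · have h1 : ‖f₁ x‖ = ‖freqMap 0 0 hψ x‖ * Real.exp (-l x) := by
      rw [hf₁, freqMap_apply, sub_eq_add_neg, Real.exp_add]
      simp only [norm_mul, Complex.norm_real, Real.norm_eq_abs, Real.abs_exp]
      ring
    have h2 : ‖f₂ x‖ = ‖freqMap 0 0 hψ x‖ * Real.exp (l x) := by
      rw [hf₂, freqMap_apply, sub_eq_add_neg, Real.exp_add]
      simp only [norm_mul, Complex.norm_real, Real.norm_eq_abs, Real.abs_exp,
        neg_apply, neg_neg]
      ring
    have h3 : Real.exp (2 * Real.pi * |inner ℝ x (toFreqSpace (w, 0))|) ≤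
        Real.exp (-l x) + Real.exp (l x) := by
      rw [hl]
      rcases abs_cases (inner ℝ x (toFreqSpace (w, 0))) with ⟨h, -⟩ | ⟨h, -⟩ <;> rw [h]
      · exact le_add_of_nonneg_left (Real.exp_pos _).le
      · rw [mul_neg]
        exact le_add_of_nonneg_right (Real.exp_pos _).le
    rw [Real.norm_of_nonneg (by positivity), Pi.add_apply, Real.norm_of_nonneg (by positivity)]
    simp only [norm_mul, h1, h2]
    calc _ ≤ ‖starRingEnd ℂ (v x)‖ * ‖freqMap 0 0 hψ x‖ * (Real.exp (-l x) + Real.exp (l x)) := by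
          gcongr
      _ = _ := by ring

theorem inner_eq_zero_of_mem_freqSpan
    (hv : ∀ (a b : ℕ) (ψ : ℝ → ℂ) (hψ : IsTestFun ψ), inner ℂ v ((freqMap a b hψ).toLp 2) = 0)
    {g : 𝓢(FreqSpace, ℂ)} (hg : g ∈ freqSpan) : inner ℂ v (g.toLp 2) = 0 := by
  have hlin : ∀ g : 𝓢(FreqSpace, ℂ), g.toLp 2 (volume : Measure FreqSpace) =
    toLpCLM ℂ ℂ 2 (volume : Measure FreqSpace) g := fun _ => rfl
  induction hg using Submodule.span_induction with
  | mem g hg =>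
    obtain ⟨a, b, ψ, hψ, rfl⟩ := hg
    exact hv a b ψ hψ
  | zero => rw [hlin, map_zero, inner_zero_right]
  | add f g _ _ hf hg =>
    rw [hlin] at hf hg ⊢
    rw [map_add, inner_add_right, hf, hg, add_zero]
  | smul c g _ hg =>
    rw [hlin] at hg ⊢
    rw [map_smul, inner_smul_right, hg, mul_zero]

/-- The exponential is expanded in powers of a linear form in `ξ`. Each power times `freqMap 0 0`
stays in `freqSpan`, so every term integrates to zero; `integrable_norm_mul_exp` dominates the
series. -/
theorem integral_exp_inner_mul_eq_zero
    (hv : ∀ (a b : ℕ) (ψ : ℝ → ℂ) (hψ : IsTestFun ψ), inner ℂ v ((freqMap a b hψ).toLp 2) = 0)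
    (w : ℂ) {ψ : ℝ → ℂ} (hψ : IsTestFun ψ) :
    ∫ x, Complex.exp (((-2 * Real.pi * inner ℝ x (toFreqSpace (w, 0)) : ℝ) : ℂ) * Complex.I) *
      (starRingEnd ℂ (v x) * freqMap 0 0 hψ x) = 0 := by
  set p : FreqSpace → ℝ := fun x => inner ℝ x (toFreqSpace (w, 0)) with hp
  have hexp : ∀ z : ℂ, HasSum (fun n : ℕ => z ^ n / n.factorial) (Complex.exp z) := by
    intro z
    rw [Complex.exp_eq_exp_ℂ]
    exact NormedSpace.expSeries_div_hasSum_exp z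
  have hexp' : ∀ z : ℝ, HasSum (fun n : ℕ => z ^ n / n.factorial) (Real.exp z) := by
    intro z
    rw [Real.exp_eq_exp_ℝ]
    exact NormedSpace.expSeries_div_hasSum_exp z
  have hsum := hasSum_integral_of_dominated_convergence (μ := (volume : Measure FreqSpace))
    (F := fun (n : ℕ) x => (((-2 * Real.pi * p x : ℝ) : ℂ) * Complex.I) ^ n / n.factorial *
      (starRingEnd ℂ (v x) * freqMap 0 0 hψ x))
    (f := fun x => Complex.exp (((-2 * Real.pi * p x : ℝ) : ℂ) * Complex.I) *
      (starRingEnd ℂ (v x) * freqMap 0 0 hψ x))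
    (fun n x => ‖starRingEnd ℂ (v x) * freqMap 0 0 hψ x‖ *
      ((2 * Real.pi * |p x|) ^ n / n.factorial)) ?_ ?_ ?_ ?_ ?_
  · refine hsum.unique ?_
    have hz : ∀ n : ℕ, ∫ x, (((-2 * Real.pi * p x : ℝ) : ℂ) * Complex.I) ^ n / n.factorial *
        (starRingEnd ℂ (v x) * freqMap 0 0 hψ x) = 0 := by
      intro n
      obtain ⟨g, hg, hgx⟩ := exists_freqSpan_eq_inner_pow_mul w hψ n
      have h0 := inner_eq_zero_of_mem_freqSpan hv hg
      rw [inner_toLp_eq_integral] at h0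
      rw [← mul_zero ((-2 * Real.pi * Complex.I) ^ n / n.factorial : ℂ), ← h0,
        ← integral_const_mul]
      refine integral_congr_ae (Filter.Eventually.of_forall fun x => ?_)
      simp only [hgx, hp]
      push_cast
      ring
    simp only [hz]
    exact hasSum_zero
  · intro n
    refine AEStronglyMeasurable.mul (Continuous.aestronglyMeasurable ?_)
      (integrable_conj_mul v _).aestronglyMeasurable
    simp only [hp]
    fun_prop
  · refine fun n => Filter.Eventually.of_forall fun x => le_of_eq ?_
    rw [norm_mul, mul_comm]
    congr 1
    simp [abs_of_pos Real.pi_pos]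
  · exact Filter.Eventually.of_forall fun x => ((hexp' _).mul_left _).summable
  · refine (integrable_norm_mul_exp v w hψ).congr (Filter.Eventually.of_forall fun x => ?_)
    exact ((hexp' _).mul_left _).tsum_eq.symm
  · exact Filter.Eventually.of_forall fun x => (hexp _).mul_right _

theorem ae_conj_mul_freqMap_eq_zero
    (hv : ∀ (a b : ℕ) (ψ : ℝ → ℂ) (hψ : IsTestFun ψ), inner ℂ v ((freqMap a b hψ).toLp 2) = 0)
    {ψ : ℝ → ℂ} (hψ : IsTestFun ψ) :
    ∀ᵐ x : FreqSpace, starRingEnd ℂ (v x) * freqMap 0 0 hψ x = 0 := by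
  refine ae_eq_zero_of_fourier_eq_zero (integrable_conj_mul v _) fun y => ?_
  rw [Real.fourier_eq']
  -- The oscillation in `μ` is absorbed into the arbitrary test function; only the `ξ` oscillation
  -- needs the power series.
  have hψ' : IsTestFun (fun t => Complex.exp (((-2 * Real.pi * y.snd * t : ℝ) : ℂ) * Complex.I) *
      ψ t) := hψ.mul_left fun t _ => by
    refine ContDiffAt.cexp (ContDiffAt.mul ?_ contDiffAt_const)
    exact Complex.ofRealCLM.contDiff.contDiffAt.comp t (contDiffAt_const.mul contDiffAt_id)
  rw [← integral_exp_inner_mul_eq_zero hv y.fst hψ']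
  refine integral_congr_ae (Filter.Eventually.of_forall fun x => ?_)
  have hy : y = toFreqSpace (y.fst, y.snd) := rfl
  have h1 : inner ℝ x y = inner ℝ x (toFreqSpace (y.fst, 0)) + x.snd * y.snd := by
    conv_lhs => rw [hy]
    rw [inner_toFreqSpace, inner_toFreqSpace]
    ring
  simp only [freqMap_apply, h1, smul_eq_mul]
  rw [show (((-2 * Real.pi * (inner ℝ x (toFreqSpace (y.fst, 0)) + x.snd * y.snd) : ℝ) : ℂ) *
    Complex.I) = ((-2 * Real.pi * inner ℝ x (toFreqSpace (y.fst, 0)) : ℝ) : ℂ) * Complex.I +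
    ((-2 * Real.pi * y.snd * x.snd : ℝ) : ℂ) * Complex.I by push_cast; ring, Complex.exp_add]
  ring

theorem exists_isTestFun_eq_one (n : ℕ) : ∃ ψ : ℝ → ℂ, IsTestFun ψ ∧
    ∀ t : ℝ, 1 / ((n : ℝ) + 1) ≤ |t| → |t| ≤ n + 1 → ψ t = 1 := by
  have hK : IsCompact (Set.Icc (-(n + 1) : ℝ) (n + 1) ∩ {t : ℝ | 1 / ((n : ℝ) + 1) ≤ |t|}) :=
    isCompact_Icc.inter_right (isClosed_le continuous_const continuous_abs)
  obtain ⟨χ, hχ, hcs, hts, -, hone⟩ := exists_contDiff_cutoff hK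
    (isOpen_compl_singleton (x := (0 : ℝ))) (by
      rintro t ⟨-, ht⟩ h0
      rw [Set.mem_singleton_iff] at h0
      rw [Set.mem_ofPred_eq, h0, abs_zero] at ht
      have : (0 : ℝ) < 1 / ((n : ℝ) + 1) := by positivity
      linarith)
  refine ⟨fun t => (χ t : ℂ), ⟨Complex.ofRealCLM.contDiff.comp hχ,
    hcs.comp_left (g := fun r : ℝ => (r : ℂ)) Complex.ofReal_zero, fun h => ?_⟩, ?_⟩
  · exact hts (closure_mono (Function.support_comp_subset Complex.ofReal_zero χ) h) rfl
  · intro t h1 h2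
    dsimp only
    rw [hone t ⟨⟨(abs_le.1 h2).1, (abs_le.1 h2).2⟩, h1⟩, Complex.ofReal_one]

theorem ae_snd_ne_zero : ∀ᵐ x : FreqSpace, x.snd ≠ 0 := by
  let ps : FreqSpace →L[ℝ] ℝ := WithLp.sndL 2 ℝ ℂ ℝ
  have h := Measure.addHaar_submodule (volume : Measure FreqSpace)
    (LinearMap.ker ps.toLinearMap) (fun h => by
      have h1 : toFreqSpace (0, 1) ∈ LinearMap.ker ps.toLinearMap := h ▸ Submodule.mem_top
      have h2 : (1 : ℝ) = 0 := h1
      exact one_ne_zero h2)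
  refine measure_mono_null (fun x hx => ?_) h
  simp only [Set.mem_compl_iff, Set.mem_ofPred_eq, not_not] at hx
  exact hx

/-- Countably many test functions, each 1 on a growing annulus, cover `μ ≠ 0`, and the Gaussian
factor never vanishes. -/
theorem eq_zero_of_inner_freqMap_eq_zero
    (hv : ∀ (a b : ℕ) (ψ : ℝ → ℂ) (hψ : IsTestFun ψ), inner ℂ v ((freqMap a b hψ).toLp 2) = 0) :
    v = 0 := by
  choose ψ hψ hone using exists_isTestFun_eq_one
  have hall : ∀ᵐ x : FreqSpace, ∀ n : ℕ, starRingEnd ℂ (v x) * freqMap 0 0 (hψ n) x = 0 :=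
    ae_all_iff.2 fun n => ae_conj_mul_freqMap_eq_zero hv (hψ n)
  rw [Lp.eq_zero_iff_ae_eq_zero]
  filter_upwards [hall, ae_snd_ne_zero] with x hx h0
  have hpos : 0 < |x.snd| := abs_pos.2 h0
  obtain ⟨n, hn⟩ := exists_nat_ge (max |x.snd| (1 / |x.snd|))
  have h1 : 1 / ((n : ℝ) + 1) ≤ |x.snd| := by
    rw [div_le_iff₀ (by positivity), ← div_le_iff₀' hpos]
    linarith [le_max_right |x.snd| (1 / |x.snd|)]
  have h2 : |x.snd| ≤ n + 1 := by linarith [le_max_left |x.snd| (1 / |x.snd|)]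
  have h3 := hx n
  rw [freqMap_apply, hone n _ h1 h2] at h3
  simpa [Complex.exp_ne_zero] using h3

end Heisenberg

/-! ### Off the half-line: `L - lam` is bijective. -/

namespace Heisenberg

open scoped FourierTransform

/-- Skew-symmetry of `X` and `Y` makes the quadratic form `‖Xf‖² + ‖Yf‖²`. -/
theorem exists_inner_subLaplacian_eq (u : subLaplacian.domain) :
    ∃ r : ℝ, 0 ≤ r ∧ inner ℂ (u : L2) (subLaplacian u) = r := by
  obtain ⟨_, f, rfl⟩ := u
  refine ⟨‖schwartzIncl (fieldX f)‖ ^ 2 + ‖schwartzIncl (fieldY f)‖ ^ 2, by positivity, ?_⟩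
  change inner ℂ (schwartzIncl f) (subLaplacian ⟨schwartzIncl f, f, rfl⟩) = _
  rw [subLaplacian_apply f ⟨f, rfl⟩]
  change inner ℂ (schwartzIncl f)
    (schwartzIncl (-(fieldX (fieldX f) + fieldY (fieldY f)))) = _
  rw [map_neg, map_add, inner_neg_right, inner_add_right, neg_add, ← inner_fieldX, ← inner_fieldY,
    inner_self_eq_norm_sq_to_K, inner_self_eq_norm_sq_to_K]
  simp

theorem isClosed_subLaplacianClosure : subLaplacianClosure.IsClosed :=
  isClosable_subLaplacian.closure_isClosed

theorem mem_graph_subLaplacianClosure (f : 𝓢(H3, ℂ)) :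
    (schwartzIncl f, schwartzIncl (subLaplacianSchwartz f)) ∈ subLaplacianClosure.graph := by
  refine LinearPMap.le_graph_of_le subLaplacian.le_closure ?_
  rw [LinearPMap.mem_graph_iff]
  exact ⟨⟨schwartzIncl f, f, rfl⟩, rfl, subLaplacian_apply f ⟨f, rfl⟩⟩

theorem inner_graph_subLaplacianClosure (f : 𝓢(H3, ℂ)) :
    ∀ p ∈ subLaplacianClosure.graph,
      inner ℂ p.2 (schwartzIncl f) = inner ℂ p.1 (schwartzIncl (subLaplacianSchwartz f)) := by
  refine LinearPMap.graph_closure_induction isClosable_subLaplacian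
    (P := fun p : L2 × L2 =>
      inner ℂ p.2 (schwartzIncl f) = inner ℂ p.1 (schwartzIncl (subLaplacianSchwartz f)))
    (isClosed_eq (by fun_prop) (by fun_prop)) fun u => ?_
  have h := isFormalAdjoint_subLaplacian u ⟨schwartzIncl f, f, rfl⟩
  rw [subLaplacian_apply f ⟨f, rfl⟩] at h
  exact h

theorem exists_bound_subLaplacianClosure {lam : ℂ}
    (hlam : lam ∉ (fun r : ℝ => (r : ℂ)) '' Set.Ici 0) :
    ∃ c : ℝ, 0 < c ∧ ∀ p ∈ subLaplacianClosure.graph, c * ‖p.1‖ ≤ ‖p.2 - lam • p.1‖ := by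
  obtain ⟨c, hc, h⟩ := LinearPMap.dist_bound_of_nonneg exists_inner_subLaplacian_eq hlam
  exact ⟨c, hc, LinearPMap.graph_closure_induction isClosable_subLaplacian
    (P := fun p : L2 × L2 => c * ‖p.1‖ ≤ ‖p.2 - lam • p.1‖)
    (isClosed_le (by fun_prop) (by fun_prop)) h⟩

theorem contDiffAt_level_sub (a b : ℕ) (lam : ℂ) {t : ℝ} (ht : t ≠ 0) :
    ContDiffAt ℝ ∞ (fun t : ℝ => (level a b t : ℂ) - lam) t :=
  (contDiffAt_level a b ht).sub contDiffAt_const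

theorem subLaplacianSchwartz_sub_smul_freqMap (a b : ℕ) {ψ : ℝ → ℂ} (hψ : IsTestFun ψ) (lam : ℂ) :
    subLaplacianSchwartz (invFourier (freqMap a b hψ)) - lam • invFourier (freqMap a b hψ) =
      invFourier (freqMap a b (hψ.mul_left_of_ne_zero fun _ ht => contDiffAt_level_sub a b lam ht)) -
        (16 * a * b : ℂ) • invFourier (freqMap (a - 1) (b - 1)
          (hψ.mul_left fun t _ => (contDiffAt_ofReal t).pow 2)) := by
  rw [subLaplacianSchwartz_invFourier_freqMap, ← map_smul, ← map_sub, ← map_smul, ← map_sub]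
  congr 1
  ext x
  simp only [sub_apply, smul_apply, freqMap_apply, smul_eq_mul]
  ring

theorem isTestFun_div {ψ : ℝ → ℂ} (hψ : IsTestFun ψ) (a b : ℕ) {lam : ℂ}
    (hlam : ∀ t ∈ tsupport ψ, (level a b t : ℂ) ≠ lam) :
    IsTestFun (fun t => ((level a b t : ℂ) - lam)⁻¹ * ψ t) :=
  hψ.mul_left fun t ht => (contDiffAt_level_sub a b lam fun h => hψ.zero_notMem (h ▸ ht)).inv
    (sub_ne_zero.2 (hlam t ht))

/-- The functions `freqMap a b ψ` arise from `L - lam` if `lam` is not a level on the support. -/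
theorem invFourier_freqMap_eq (a b : ℕ) {ψ : ℝ → ℂ} (hψ : IsTestFun ψ) {lam : ℂ}
    (hlam : ∀ t ∈ tsupport ψ, (level a b t : ℂ) ≠ lam) :
    invFourier (freqMap a b hψ) =
      (subLaplacianSchwartz (invFourier (freqMap a b (isTestFun_div hψ a b hlam))) -
        lam • invFourier (freqMap a b (isTestFun_div hψ a b hlam))) +
      (16 * a * b : ℂ) • invFourier (freqMap (a - 1) (b - 1)
        ((isTestFun_div hψ a b hlam).mul_left fun t _ => (contDiffAt_ofReal t).pow 2)) := by
  rw [subLaplacianSchwartz_sub_smul_freqMap, sub_add_cancel]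
  congr 1
  ext x
  rw [freqMap_apply, freqMap_apply]
  by_cases hx : x.snd ∈ tsupport ψ
  · rw [mul_inv_cancel_left₀ (sub_ne_zero.2 (hlam _ hx))]
  · simp [image_eq_zero_of_notMem_tsupport hx]

theorem schwartzIncl_sub_smul_mem_range (f : 𝓢(H3, ℂ)) (lam : ℂ) :
    schwartzIncl (subLaplacianSchwartz f - lam • f) ∈
      LinearMap.range (subLaplacianClosure.subScalar lam) := by
  rw [LinearPMap.mem_range_subScalar_iff]
  exact ⟨_, mem_graph_subLaplacianClosure f, by rw [map_sub, map_smul]⟩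

/-- Modulo the range, `invFourier_freqMap_eq` lowers both indices by one; at `a = 0` the remainder
has coefficient zero. The induction on `a` leaves `b` and `ψ` free since both change. -/
theorem inner_invFourier_freqMap_eq_zero {lam : ℂ}
    (hlam : lam ∉ (fun r : ℝ => (r : ℂ)) '' Set.Ici 0) {v : L2}
    (hv : ∀ y ∈ LinearMap.range (subLaplacianClosure.subScalar lam), inner ℂ v y = 0) (a : ℕ) :
    ∀ (b : ℕ) (ψ : ℝ → ℂ) (hψ : IsTestFun ψ),
      inner ℂ v (schwartzIncl (invFourier (freqMap a b hψ))) = 0 := by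
  have hne : ∀ a b t, (level a b t : ℂ) ≠ lam := fun a b t h => hlam ⟨_, level_nonneg a b t, h⟩
  induction a with
  | zero =>
    intro b ψ hψ
    rw [invFourier_freqMap_eq 0 b hψ (lam := lam) fun t _ => hne 0 b t, map_add, inner_add_right,
      hv _ (schwartzIncl_sub_smul_mem_range _ lam)]
    simp
  | succ a ih =>
    intro b ψ hψ
    rw [invFourier_freqMap_eq (a + 1) b hψ (lam := lam) fun t _ => hne (a + 1) b t, map_add,
      inner_add_right, hv _ (schwartzIncl_sub_smul_mem_range _ lam), map_smul, inner_smul_right,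
      Nat.add_sub_cancel, ih, mul_zero, add_zero]

theorem range_subScalar_eq_top {lam : ℂ} (hlam : lam ∉ (fun r : ℝ => (r : ℂ)) '' Set.Ici 0) :
    LinearMap.range (subLaplacianClosure.subScalar lam) = ⊤ := by
  obtain ⟨c, hc, hbound⟩ := exists_bound_subLaplacianClosure hlam
  have hclosed := LinearPMap.isClosed_range_of_bound isClosed_subLaplacianClosure hc hbound
  rw [← hclosed.submodule_topologicalClosure_eq, Submodule.topologicalClosure_eq_top_iff,
    Submodule.eq_bot_iff]
  intro v hv
  rw [Submodule.mem_orthogonal'] at hv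
  refine eq_zero_of_fourier_toFreqL2_eq_zero (eq_zero_of_inner_freqMap_eq_zero ?_)
  intro a b ψ hψ
  rw [← inner_schwartzIncl_invFourier]
  exact inner_invFourier_freqMap_eq_zero hlam hv a b ψ hψ

/-! ### On the half-line: the range is not closed. -/

theorem exists_isTestFun_support_subset {r ε : ℝ} (hr : 0 ≤ r) (hε : 0 < ε) :
    ∃ ψ : ℝ → ℂ, IsTestFun ψ ∧ (∃ t, ψ t ≠ 0) ∧
      ∀ t ∈ tsupport ψ, r < level 0 0 t ∧ level 0 0 t < r + ε := by
  have hpi : 0 < 8 * Real.pi := by have := Real.pi_pos; positivity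
  have hmem : (r + ε / 2) / (8 * Real.pi) ∈
      Set.Ioo (r / (8 * Real.pi)) ((r + ε) / (8 * Real.pi)) :=
    ⟨div_lt_div_of_pos_right (by linarith) hpi, div_lt_div_of_pos_right (by linarith) hpi⟩
  obtain ⟨χ, hχ, hcs, hts, -, hone⟩ := exists_contDiff_cutoff
    (isCompact_singleton (x := (r + ε / 2) / (8 * Real.pi))) isOpen_Ioo
    (Set.singleton_subset_iff.2 hmem)
  have hts' : tsupport (fun t => (χ t : ℂ)) ⊆
      Set.Ioo (r / (8 * Real.pi)) ((r + ε) / (8 * Real.pi)) :=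
    (closure_mono (Function.support_comp_subset Complex.ofReal_zero χ)).trans hts
  have hr' : 0 ≤ r / (8 * Real.pi) := by positivity
  refine ⟨fun t => (χ t : ℂ), ⟨Complex.ofRealCLM.contDiff.comp hχ,
    hcs.comp_left (g := fun r : ℝ => (r : ℂ)) Complex.ofReal_zero, fun h => ?_⟩,
    ⟨(r + ε / 2) / (8 * Real.pi), by simp [hone]⟩, fun t ht => ?_⟩
  · exact absurd (hts' h).1 (not_lt.2 hr')
  · obtain ⟨h1, h2⟩ := hts' ht
    rw [level_zero_zero, abs_of_pos (hr'.trans_lt h1)]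
    rw [div_lt_iff₀' hpi] at h1
    rw [lt_div_iff₀' hpi] at h2
    exact ⟨h1, h2⟩

theorem schwartzIncl_invFourier_freqMap_ne_zero {ψ : ℝ → ℂ} (hψ : IsTestFun ψ)
    (h : ∃ t, ψ t ≠ 0) : schwartzIncl (invFourier (freqMap 0 0 hψ)) ≠ 0 := by
  intro h0
  obtain ⟨t, ht⟩ := h
  rw [← norm_eq_zero, norm_schwartzIncl_invFourier, norm_eq_zero] at h0
  have h1 : freqMap 0 0 hψ = 0 := injective_toLp (F := ℂ) 2 (volume : Measure FreqSpace)
    (h0.trans (map_zero (toLpCLM ℂ ℂ 2 (volume : Measure FreqSpace))).symm)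
  have h2 := freqMap_apply 0 0 hψ (toFreqSpace (0, t))
  rw [h1] at h2
  exact ht (by simpa [toFreqSpace_apply] using h2.symm)

/-- For `a = b = 0` the triangular correction vanishes, so on the Fourier side the operator is
multiplication by `level 0 0 μ - r`, of size below `ε` on the support. -/
theorem norm_sub_smul_freqMap_le {r ε : ℝ} {ψ : ℝ → ℂ} (hψ : IsTestFun ψ)
    (h : ∀ t ∈ tsupport ψ, r < level 0 0 t ∧ level 0 0 t < r + ε) :
    ‖schwartzIncl (subLaplacianSchwartz (invFourier (freqMap 0 0 hψ)) -
        (r : ℂ) • invFourier (freqMap 0 0 hψ))‖ ≤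
      ε * ‖schwartzIncl (invFourier (freqMap 0 0 hψ))‖ := by
  rw [subLaplacianSchwartz_sub_smul_freqMap]
  simp only [Nat.cast_zero, mul_zero, zero_smul, sub_zero]
  rw [norm_schwartzIncl_invFourier, norm_schwartzIncl_invFourier]
  refine Lp.norm_le_mul_norm_of_ae_le_mul ?_
  filter_upwards [coeFn_toLp (freqMap 0 0 hψ) 2 (volume : Measure FreqSpace),
    coeFn_toLp (freqMap 0 0 (hψ.mul_left_of_ne_zero fun _ ht => contDiffAt_level_sub 0 0 r ht)) 2
      (volume : Measure FreqSpace)] with x h1 h2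
  rw [h1, h2, freqMap_apply, freqMap_apply]
  by_cases hx : x.snd ∈ tsupport ψ
  · obtain ⟨h3, h4⟩ := h _ hx
    rw [mul_left_comm, norm_mul]
    refine mul_le_mul_of_nonneg_right ?_ (norm_nonneg _)
    rw [← Complex.ofReal_sub, Complex.norm_real, Real.norm_of_nonneg (by linarith)]
    linarith
  · simp [image_eq_zero_of_notMem_tsupport hx]

theorem not_isClosed_range_subScalar {r : ℝ} (hr : 0 ≤ r) :
    ¬ IsClosed (LinearMap.range (subLaplacianClosure.subScalar r) : Set L2) := by
  intro hclosed
  obtain ⟨C, hC, hpre⟩ :=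
    LinearPMap.exists_preimage_of_isClosed_range isClosed_subLaplacianClosure hclosed
  obtain ⟨ψ, hψ, hne, hsupp⟩ := exists_isTestFun_support_subset hr
    (show 0 < 1 / (2 * C) by positivity)
  -- The level stays strictly above `r` on the support, so division by `level - r` is allowed and
  -- puts `f` itself in the range.
  have hlevel : ∀ t ∈ tsupport ψ, (level 0 0 t : ℂ) ≠ r := fun t ht h =>
    (hsupp t ht).1.ne' (Complex.ofReal_injective h)
  set f := invFourier (freqMap 0 0 hψ) with hf
  set f' := invFourier (freqMap 0 0 (isTestFun_div hψ 0 0 hlevel)) with hf'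
  have hff' : f = subLaplacianSchwartz f' - (r : ℂ) • f' := by
    rw [hf, invFourier_freqMap_eq 0 0 hψ hlevel, Nat.cast_zero, mul_zero, zero_smul, add_zero]
  obtain ⟨q, hq, hqeq, hqle⟩ := hpre _ (mem_graph_subLaplacianClosure f)
  dsimp only at hqeq hqle
  have hd := subLaplacianClosure.graph.sub_mem (mem_graph_subLaplacianClosure f) hq
  have hsymm := inner_graph_subLaplacianClosure f' _ hd
  simp only [Prod.fst_sub, Prod.snd_sub] at hsymm
  have hker : schwartzIncl (subLaplacianSchwartz f) - q.2 = (r : ℂ) • (schwartzIncl f - q.1) := by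
    rw [smul_sub, sub_eq_sub_iff_sub_eq_sub]
    exact hqeq.symm
  -- The difference of two preimages is in the kernel, and for real `r` symmetry makes the kernel
  -- orthogonal to `(L - r)f' = f`.
  have horth : inner ℂ (schwartzIncl f - q.1) (schwartzIncl f) = 0 := by
    nth_rewrite 2 [hff']
    rw [map_sub, map_smul, inner_sub_right, ← hsymm, hker, inner_smul_left, inner_smul_right,
      Complex.conj_ofReal, sub_self]
  have hpos : 0 < ‖schwartzIncl f‖ :=
    norm_pos_iff.2 (schwartzIncl_invFourier_freqMap_ne_zero hψ hne)
  have hle : ‖schwartzIncl f‖ ≤ ‖q.1‖ := by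
    rw [inner_sub_left, sub_eq_zero, inner_self_eq_norm_sq_to_K] at horth
    have h1 := norm_inner_le_norm (𝕜 := ℂ) q.1 (schwartzIncl f)
    rw [← horth] at h1
    simp only [Complex.coe_algebraMap, norm_pow, Complex.norm_real, norm_norm] at h1
    exact le_of_mul_le_mul_right (by rw [← sq]; exact h1) hpos
  have hsmall := norm_sub_smul_freqMap_le hψ hsupp
  rw [← hf, map_sub, map_smul] at hsmall
  have h2 := mul_le_mul_of_nonneg_left hsmall hC.le
  -- The choice `ε = 1/(2C)` yields `‖f‖ ≤ ‖q.1‖ ≤ ‖f‖/2`, impossible for `f ≠ 0`.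
  rw [show C * (1 / (2 * C) * ‖schwartzIncl f‖) = ‖schwartzIncl f‖ / 2 by field_simp] at h2
  linarith

end Heisenberg

theorem theorem5 :
    Heisenberg.subLaplacianClosure.essSpectrumDS = (fun r : ℝ => (r : ℂ)) '' Set.Ici 0 ∧
    Heisenberg.subLaplacianClosure.essSpectrumWolf = (fun r : ℝ => (r : ℂ)) '' Set.Ici 0 ∧
    Heisenberg.subLaplacianClosure.essSpectrumSchechter =
      (fun r : ℝ => (r : ℂ)) '' Set.Ici 0 := by
  refine LinearPMap.essSpectra_eq_of_dichotomy ?_ (fun lam hlam => ?_)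
    fun lam hlam => Heisenberg.range_subScalar_eq_top hlam
  · rintro _ ⟨r, hr, rfl⟩
    exact Heisenberg.not_isClosed_range_subScalar hr
  · obtain ⟨c, hc, h⟩ := Heisenberg.exists_bound_subLaplacianClosure hlam
    exact LinearPMap.ker_subScalar_eq_bot hc h
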